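/- Conventions. A \emph{bigraph} $G=(V_1,V_2,E)$ consists of disjoint finite sets $V_1=V_1(G)$ (left side), $V_2=V_2(G)$ (right side) and a set $E=E(G)\subseteq V_1\times V_2$; put $e(G)=|E(G)|$ and $N_G(w)=\{v\in V_1 : (v,w)\in E\}$ for $w\in V_2$. A bigraph is \emph{non-trivial} if it has at least one edge. A \emph{colored bigraph} $H=(G(H),c)$ is a bigraph $G(H)$ with a map $c:E(G(H))\to C$ to a set $C$. An automorphism of $H$ is a bijection $\sigma$ of the vertex set that maps each side onto itself, satisfies $(v,w)\in E\iff(\sigma(v),\sigma(w))\in E$ for all $v\in V_1$, $w\in V_2$, and preserves the color of every edge; $\mathrm{Aut}(H)$ is the group of automorphisms. $H$ is \emph{right-uniform} if $c(v,w)$ depends only on $w$, and \emph{color-edge-transitive} if for any two edges $(v_1,w_1),(v_2,w_2)$ of the same color some $\sigma\in\mathrm{Aut}(H)$ has $\sigma(v_1)=v_2$ and $\sigma(w_1)=w_2$. A \emph{bigraphon} over probability spaces $(X,\mu)$, $(Y,\nu)$ is a bounded measurable function $W:X\times Y\to[0,\infty)$. For a coloring $c:E(G)\to C$ and bigraphons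 $W=(W_i)_{i\in C}$ over the same spaces let $$t((G,c),W)=\int_{X^{V_1}\times Y^{V_2}}\prod_{(v,w)\in E(G)}W_{c(v,w)}(x_v,y_w)\,d(\mu\otimes\nu)(x,y).$$ $H=(G,c)$ with color set $C$ is \emph{left-weakly H\"older} if for every set $D$, every $\ell:V_1\to D$, all probability spaces and all bigraphons $W=(W_i)_{i\in D\times C}$ over them, $$t((G,\ell\otimes c),W)\le\prod_{v\in V_1}t((G,\ell(v)\otimes c),W)^{1/|V_1|},$$ where $(\ell\otimes c)(v,w)=(\ell(v),c(v,w))$ and, on the right, $\ell(v)$ stands for the constant map on $V_1$ with value $\ell(v)$. $G$ is \emph{strong Sidorenko} if for all probability spaces $(X,\mu)$, $(Y,\nu)$, every bigraphon $W$ over them and all bounded measurable $f_v:X\to[0,\infty)$ ($v\in V_1$), $g_w:Y\to[0,\infty)$ ($w\in V_2$), $$\int_{X^{V_1}\times Y^{V_2}}\prod_{v\in V_1}f_v(x_v)\prod_{w\in V_2}g_w(y_w)\prod_{(v,w)\in E(G)}W(x_v,y_w)\,d(\mu\otimes\nu)\ \ge\ \Bigl(\int_{X\times Y}\prod_{v\in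 V_1}f_v(x)^{1/e(G)}\prod_{w\in V_2}g_w(y)^{1/e(G)}\,W(x,y)\,d(\mu\otimes\nu)\Bigr)^{e(G)}.$$ Theorem. Let $H$ be a non-trivial, right-uniform, color-edge-transitive, left-weakly H\"older colored bigraph without isolated vertices, and let $G$ be a bigraph without isolated vertices with $V_1(G)=V_1(H)$. For $U\subseteq V_1(G)$ let $d_G(U)=|\{w\in V_2(G):N_G(w)=U\}|$ and $d_H(U)=|\{w\in V_2(H):N_H(w)=U\}|$. Suppose that for every $U\subseteq V_1(G)$ with $|U|\ge 2$: \begin{enumerate} \item $\sum_{\sigma\in\mathrm{Aut}(H)}d_G(\sigma(U))=0$ if and only if $\sum_{\sigma\in\mathrm{Aut}(H)}d_H(\sigma(U))=0$; \item $\sum_{\sigma\in\mathrm{Aut}(H)}d_G(\sigma(U))\ge\sum_{\sigma\in\mathrm{Aut}(H)}d_H(\sigma(U))$. \end{enumerate} Then $G$ is strong Sidorenko. In particular, $G(H)$ is strong Sidorenko. -/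

import Mathlib

open MeasureTheory

universe u

/-- A bigraph with left side `V₁` and right side `V₂` (finite types in all uses below): a set of
edges `E ⊆ V₁ × V₂`. The two sides are different types, or are kept apart by their position in the
pair, so they are disjoint by construction. -/
structure Bigraph (V₁ V₂ : Type*) where
  E : Finset (V₁ × V₂)

namespace Bigraph

variable {V₁ V₂ : Type*}

open scoped Classical in
/-- The neighborhood of a right vertex, a set of left vertices. -/
noncomputable def rightNbhd [Fintype V₁] (G : Bigraph V₁ V₂) (w : V₂) : Finset V₁ :=
  Finset.univ.filter fun v => (v, w) ∈ G.E

open scoped Classical in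
/-- `d_G(U)`: the number of right vertices whose neighborhood is exactly `U`. -/
noncomputable def nbhdCount [Fintype V₁] [Fintype V₂] (G : Bigraph V₁ V₂) (U : Finset V₁) : ℕ :=
  (Finset.univ.filter fun w => G.rightNbhd w = U).card

/-- No vertex, left or right, is isolated. -/
def NoIsolated (G : Bigraph V₁ V₂) : Prop :=
  (∀ v : V₁, ∃ w : V₂, (v, w) ∈ G.E) ∧ (∀ w : V₂, ∃ v : V₁, (v, w) ∈ G.E)

/-- A bigraph is non-trivial if it has at least one edge. (Without isolated vertices this is the
same as having at least one vertex.) -/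
def Nontrivial (G : Bigraph V₁ V₂) : Prop :=
  G.E.Nonempty

end Bigraph

/-- Bounded measurable functions with values in the non-negative reals. On `X × Y`, with the
product σ-algebra, these are the bigraphons. -/
def IsBddMeasNonneg {α : Type*} [MeasurableSpace α] (f : α → ℝ) : Prop :=
  Measurable f ∧ (∀ a, 0 ≤ f a) ∧ ∃ M : ℝ, ∀ a, f a ≤ M

namespace Bigraph

variable {V₁ V₂ : Type*} [Fintype V₁] [Fintype V₂]

/-- The colored density `t((G,c),W)`, the integral over `X^{V₁} × Y^{V₂}` of
`∏_{(v,w) ∈ E} W_{c(v,w)}(x_v, y_w)`. -/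
noncomputable def coloredDensity {C X Y : Type*} [MeasurableSpace X] [MeasurableSpace Y]
    (G : Bigraph V₁ V₂) (c : G.E → C) (μ : Measure X) (ν : Measure Y)
    (W : C → X × Y → ℝ) : ℝ :=
  ∫ z : (V₁ → X) × (V₂ → Y), ∏ e : G.E, W (c e) (z.1 e.1.1, z.2 e.1.2)
    ∂((Measure.pi fun _ : V₁ => μ).prod (Measure.pi fun _ : V₂ => ν))

/-- The weighted density `t(G;f,g;W)`. -/
noncomputable def weightedDensity {X Y : Type*} [MeasurableSpace X] [MeasurableSpace Y]
    (G : Bigraph V₁ V₂) (μ : Measure X) (ν : Measure Y)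
    (f : V₁ → X → ℝ) (g : V₂ → Y → ℝ) (W : X × Y → ℝ) : ℝ :=
  ∫ z : (V₁ → X) × (V₂ → Y),
      (∏ v, f v (z.1 v)) * (∏ w, g w (z.2 w)) * ∏ e ∈ G.E, W (z.1 e.1, z.2 e.2)
    ∂((Measure.pi fun _ : V₁ => μ).prod (Measure.pi fun _ : V₂ => ν))

/-- The edge density `t(ρ; ∏_v f_v^{1/e(G)}, ∏_w g_w^{1/e(G)}; W)`. -/
noncomputable def weightedEdgeDensity {X Y : Type*} [MeasurableSpace X] [MeasurableSpace Y]
    (G : Bigraph V₁ V₂) (μ : Measure X) (ν : Measure Y)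
    (f : V₁ → X → ℝ) (g : V₂ → Y → ℝ) (W : X × Y → ℝ) : ℝ :=
  ∫ z : X × Y,
      (∏ v, f v z.1 ^ (1 / (G.E.card : ℝ))) * (∏ w, g w z.2 ^ (1 / (G.E.card : ℝ))) * W z
    ∂(μ.prod ν)

/-- Strong Sidorenko bigraphs; the probability spaces range over a universe `a`. -/
def StrongSidorenko.{a, b, c} {V₁ : Type b} {V₂ : Type c} [Fintype V₁] [Fintype V₂]
    (G : Bigraph V₁ V₂) : Prop :=
  ∀ (X Y : Type a) [MeasurableSpace X] [MeasurableSpace Y]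
    (μ : Measure X) (ν : Measure Y) [IsProbabilityMeasure μ] [IsProbabilityMeasure ν]
    (W : X × Y → ℝ) (f : V₁ → X → ℝ) (g : V₂ → Y → ℝ),
    IsBddMeasNonneg W → (∀ v, IsBddMeasNonneg (f v)) → (∀ w, IsBddMeasNonneg (g w)) →
      G.weightedEdgeDensity μ ν f g W ^ G.E.card ≤ G.weightedDensity μ ν f g W

end Bigraph

/-- A colored bigraph: a bigraph together with a coloring of its edges. -/
structure ColoredBigraph (V₁ V₂ C : Type*) where
  graph : Bigraph V₁ V₂
  color : graph.E → C

namespace ColoredBigraph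

variable {V₁ V₂ C : Type*}

/-- The coloring is a function of the right endpoint. -/
def RightUniform (H : ColoredBigraph V₁ V₂ C) : Prop :=
  ∃ f : V₂ → C, ∀ e : H.graph.E, H.color e = f e.1.2

/-- An automorphism of `H` is a pair of permutations of the two sides that preserves edges,
non-edges and the colors of edges. -/
def IsAut (H : ColoredBigraph V₁ V₂ C) (σ : Equiv.Perm V₁ × Equiv.Perm V₂) : Prop :=
  (∀ v w, (v, w) ∈ H.graph.E ↔ (σ.1 v, σ.2 w) ∈ H.graph.E) ∧
    ∀ e e' : H.graph.E, e'.1 = (σ.1 e.1.1, σ.2 e.1.2) → H.color e = H.color e'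

open scoped Classical in
/-- The automorphism group of `H`, as a finite set. -/
noncomputable def Aut [Fintype V₁] [Fintype V₂] (H : ColoredBigraph V₁ V₂ C) :
    Finset (Equiv.Perm V₁ × Equiv.Perm V₂) :=
  Finset.univ.filter fun σ => H.IsAut σ

/-- Any two edges of the same color are mapped to each other by an automorphism of `H`. -/
def ColorEdgeTransitive (H : ColoredBigraph V₁ V₂ C) : Prop :=
  ∀ e e' : H.graph.E, H.color e = H.color e' →
    ∃ σ : Equiv.Perm V₁ × Equiv.Perm V₂, H.IsAut σ ∧ σ.1 e.1.1 = e'.1.1 ∧ σ.2 e.1.2 = e'.1.2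

/-- The edge coloring `(ℓ ⊗ c)(v,w) = (ℓ(v), c(v,w))`. -/
def leftTensor {D : Type*} (H : ColoredBigraph V₁ V₂ C) (ℓ : V₁ → D) : H.graph.E → D × C :=
  fun e => (ℓ e.1.1, H.color e)

/-- Left-weakly Hölder colored bigraphs; the probability spaces range over a universe `a`. As the
left side is finite, it makes no difference in which universe the set `D` of left colors lies. -/
def LeftWeaklyHolder.{a, b, c, d} {V₁ : Type b} {V₂ : Type c} {C : Type d}
    [Fintype V₁] [Fintype V₂] (H : ColoredBigraph V₁ V₂ C) : Prop :=
  ∀ (D : Type) (ℓ : V₁ → D) (X Y : Type a) [MeasurableSpace X] [MeasurableSpace Y]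
    (μ : Measure X) (ν : Measure Y) [IsProbabilityMeasure μ] [IsProbabilityMeasure ν]
    (W : D × C → X × Y → ℝ), (∀ i, IsBddMeasNonneg (W i)) →
      H.graph.coloredDensity (H.leftTensor ℓ) μ ν W ≤
        ∏ v : V₁, H.graph.coloredDensity (H.leftTensor fun _ => ℓ v) μ ν W ^
          (1 / (Fintype.card V₁ : ℝ))

/-- `∑_{σ ∈ Aut(H)} d_G(σ(U))`, for a bigraph `G` on the same left side as `H`. -/
noncomputable def orbitSum {V₂' : Type*} [Fintype V₁] [Fintype V₂] [Fintype V₂']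
    (H : ColoredBigraph V₁ V₂ C) (G : Bigraph V₁ V₂') (U : Finset V₁) : ℕ :=
  ∑ σ ∈ H.Aut, G.nbhdCount (U.map σ.1.toEmbedding)

end ColoredBigraph

/-! Call a kernel `K` on finite sets with uniform measures left-regular if all its row averages are
1. The proof shows that `G` has density at least 1 for every such kernel, and that this already
implies the strong Sidorenko property.

For `H`, apply the Hölder inequality with `K` kept at all edges of one left vertex, and replaced by
1 on the edges with color in `S` at the other left vertices. Regularity averages out the leftover
pendant edges. With `T` the density of `H` and `T'` the density after deleting the colors in `S`,
this reads `T' ≤ T^(1/m) * T'^(1-1/m)`, where `m = |V₁|`, so `T' ≤ T` (`avgDensity_delete_le`).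
Deleting all colors gives `1 ≤ T`. A tangent-line bound, combined with deleting one color at a time,
shows that the average stays at least 1 when the factors of each color are raised to a power at
least 1 (`one_le_expect_prod_rpow`).

For `G`, the density is invariant under relabelling left vertices, so AM-GM over `Aut(H)` bounds it
below by an expression in which the exponent of `U` is the average of `d_G` over the images of `U`.
Where `d_H(U)` is nonzero and `|U| ≥ 2`, this exponent is `d_H(U)` times a ratio that is at least 1
and depends only on the color, so the bound for `H` applies.

The passage to arbitrary kernels is a tensor-power argument. The `n`-th power of a weighted edge sum
is a sum over words of length `n`, and up to a polynomial factor one orbit under permuting positions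
carries it. That orbit is a 0-1 kernel with constant row sums between its two projections, and the
weights are constant on orbits. Letting `n` grow gives the weighted finite inequality
(`LeftRegularSidorenko.pow_le`); general probability spaces follow by sampling points. -/

open scoped BigOperators in
theorem Fintype.expect_prod_pi {ι B : Type*} [Fintype ι] [Fintype B] [DecidableEq ι]
    (h : ι → B → ℝ) : 𝔼 y : ι → B, ∏ w, h w (y w) = ∏ w, 𝔼 b, h w b := by
  simp only [Fintype.expect_eq_sum_div_card, Finset.prod_div_distrib, Finset.prod_const,
    Finset.card_univ, Fintype.card_fun, Nat.cast_pow]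
  rw [Finset.prod_univ_sum, Fintype.piFinset_univ]

/-! ### Densities over finite sets with uniform measures. -/

namespace Bigraph

theorem mem_rightNbhd {V₁ V₂ : Type*} [Fintype V₁] (G : Bigraph V₁ V₂) (v : V₁) (w : V₂) :
    v ∈ G.rightNbhd w ↔ (v, w) ∈ G.E := by
  simp [rightNbhd]

theorem prod_edges {V₁ V₂ : Type*} [Fintype V₁] [Fintype V₂] (G : Bigraph V₁ V₂)
    (F : V₁ → V₂ → ℝ) : ∏ e ∈ G.E, F e.1 e.2 = ∏ w, ∏ v ∈ G.rightNbhd w, F v w :=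
  Finset.prod_finset_product_right' _ _ _ fun p => by simp [mem_rightNbhd]

open scoped BigOperators in
/-- The density of a bigraph over two finite sets with uniform measures, where each edge carries
its own kernel. -/
noncomputable def avgDensity {V₁ V₂ A B : Type*} [Fintype V₁] [DecidableEq V₁] [Fintype V₂]
    [Fintype A] [Fintype B] (G : Bigraph V₁ V₂) (K : V₁ → V₂ → A → B → ℝ) : ℝ :=
  𝔼 x : V₁ → A, ∏ w, 𝔼 b : B, ∏ v ∈ G.rightNbhd w, K v w (x v) b

open scoped BigOperators in
theorem expect_edges {V₁ V₂ A B : Type*} [Fintype V₁] [DecidableEq V₁] [Fintype V₂]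
    [DecidableEq V₂] [Fintype A] [Fintype B] (G : Bigraph V₁ V₂) (K : V₁ → V₂ → A → B → ℝ) :
    𝔼 x : V₁ → A, 𝔼 y : V₂ → B, ∏ e ∈ G.E, K e.1 e.2 (x e.1) (y e.2) = G.avgDensity K := by
  refine Finset.expect_congr rfl fun x _ => ?_
  rw [← Fintype.expect_prod_pi fun w b => ∏ v ∈ G.rightNbhd w, K v w (x v) b]
  refine Finset.expect_congr rfl fun y _ => ?_
  exact G.prod_edges fun v w => K v w (x v) (y w)

theorem avgDensity_nonneg {V₁ V₂ A B : Type*} [Fintype V₁] [DecidableEq V₁] [Fintype V₂]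
    [Fintype A] [Fintype B] (G : Bigraph V₁ V₂) {K : V₁ → V₂ → A → B → ℝ}
    (hK : ∀ v w a b, 0 ≤ K v w a b) : 0 ≤ G.avgDensity K :=
  Finset.expect_nonneg fun _ _ => Finset.prod_nonneg fun _ _ => Finset.expect_nonneg fun _ _ =>
    Finset.prod_nonneg fun _ _ => hK _ _ _ _

end Bigraph

open scoped BigOperators in
theorem integral_uniformOn_pi_prod {V₁ V₂ A B : Type*} [Fintype V₁] [Fintype V₂] [Fintype A]
    [Fintype B] [DecidableEq V₁] [DecidableEq V₂] [Nonempty A] [Nonempty B]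
    [MeasurableSpace A] [MeasurableSpace B]
    [MeasurableSingletonClass A] [MeasurableSingletonClass B] (F : (V₁ → A) × (V₂ → B) → ℝ) :
    ∫ z, F z ∂((Measure.pi fun _ : V₁ => ProbabilityTheory.uniformOn (Set.univ : Set A)).prod
      (Measure.pi fun _ : V₂ => ProbabilityTheory.uniformOn (Set.univ : Set B))) =
      𝔼 x : V₁ → A, 𝔼 y : V₂ → B, F (x, y) := by
  have := ProbabilityTheory.isProbabilityMeasure_uniformOn (s := (Set.univ : Set A))
    Set.finite_univ Set.univ_nonempty
  have := ProbabilityTheory.isProbabilityMeasure_uniformOn (s := (Set.univ : Set B))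
    Set.finite_univ Set.univ_nonempty
  have hA (x : V₁ → A) : (Measure.pi fun _ : V₁ => ProbabilityTheory.uniformOn
      (Set.univ : Set A)).real {x} = ((Fintype.card (V₁ → A) : ℝ))⁻¹ := by
    simp [measureReal_def, ProbabilityTheory.uniformOn_univ]
  have hB (y : V₂ → B) : (Measure.pi fun _ : V₂ => ProbabilityTheory.uniformOn
      (Set.univ : Set B)).real {y} = ((Fintype.card (V₂ → B) : ℝ))⁻¹ := by
    simp [measureReal_def, ProbabilityTheory.uniformOn_univ]
  rw [integral_fintype .of_finite, Fintype.sum_prod_type]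
  simp only [Fintype.expect_eq_sum_div_card, Finset.sum_div]
  refine Finset.sum_congr rfl fun x _ => Finset.sum_congr rfl fun y _ => ?_
  rw [← Set.singleton_prod_singleton, measureReal_prod_prod, hA, hB, smul_eq_mul]
  field_simp

/-! ### The Hölder inequality on finite sets and deletion of colors. -/

namespace ColoredBigraph

/-- The left-weak Hölder inequality over finite sets with uniform measures. -/
theorem LeftWeaklyHolder.avgDensity_le {V₁ V₂ C : Type*} [Fintype V₁] [Fintype V₂] [DecidableEq V₁]
    {H : ColoredBigraph V₁ V₂ C} (hH : LeftWeaklyHolder.{u} H) {κ : V₂ → C}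
    (hκ : ∀ e : H.graph.E, H.color e = κ e.1.2) {D : Type} {A B : Type u} [Fintype A] [Fintype B]
    [Nonempty A] [Nonempty B] (ℓ : V₁ → D) (W : D → C → A → B → ℝ)
    (hW : ∀ d c a b, 0 ≤ W d c a b) :
    H.graph.avgDensity (fun v w => W (ℓ v) (κ w)) ≤
      ∏ u, H.graph.avgDensity (fun _ w => W (ℓ u) (κ w)) ^ (1 / (Fintype.card V₁ : ℝ)) := by
  classical
  let _ : MeasurableSpace A := ⊤
  let _ : MeasurableSpace B := ⊤
  have := ProbabilityTheory.isProbabilityMeasure_uniformOn (s := (Set.univ : Set A))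
    Set.finite_univ Set.univ_nonempty
  have := ProbabilityTheory.isProbabilityMeasure_uniformOn (s := (Set.univ : Set B))
    Set.finite_univ Set.univ_nonempty
  have key (m : V₁ → D) : H.graph.coloredDensity (H.leftTensor m)
      (ProbabilityTheory.uniformOn (Set.univ : Set A))
      (ProbabilityTheory.uniformOn (Set.univ : Set B)) (fun i z => W i.1 i.2 z.1 z.2) =
      H.graph.avgDensity (fun v w => W (m v) (κ w)) := by
    rw [Bigraph.coloredDensity, integral_uniformOn_pi_prod, ← Bigraph.expect_edges]
    refine Finset.expect_congr rfl fun x _ => Finset.expect_congr rfl fun y _ => ?_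
    rw [← Finset.prod_coe_sort H.graph.E]
    refine Finset.prod_congr rfl fun e _ => ?_
    simp [leftTensor, hκ e]
  have := hH D ℓ A B (ProbabilityTheory.uniformOn (Set.univ : Set A))
    (ProbabilityTheory.uniformOn (Set.univ : Set B)) (fun i z => W i.1 i.2 z.1 z.2)
    (fun i => ⟨Measurable.of_discrete, fun _ => hW _ _ _ _, by
      obtain ⟨M, hM⟩ := (Set.finite_range fun z : A × B => W i.1 i.2 z.1 z.2).bddAbove
      exact ⟨M, fun z => hM ⟨z, rfl⟩⟩⟩)
  simpa only [key] using this

open scoped BigOperators in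
open scoped Classical in
/-- Deleting the edges of some colors does not increase the density of a left-regular kernel. -/
theorem LeftWeaklyHolder.avgDensity_delete_le {V₁ V₂ C : Type*} [Fintype V₁] [Fintype V₂]
    [DecidableEq V₁] [Nonempty V₁] {H : ColoredBigraph V₁ V₂ C} (hH : LeftWeaklyHolder.{u} H)
    {κ : V₂ → C} (hκ : ∀ e : H.graph.E, H.color e = κ e.1.2) {A B : Type u} [Fintype A] [Fintype B]
    [Nonempty A] [Nonempty B] {K : A → B → ℝ} (hK : ∀ a b, 0 ≤ K a b)
    (hreg : ∀ a, 𝔼 b, K a b = 1) (S : Set C) :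
    H.graph.avgDensity (fun _ w a b => if κ w ∈ S then 1 else K a b) ≤
      H.graph.avgDensity (fun _ _ => K) := by
  obtain ⟨v₀⟩ := ‹Nonempty V₁›
  set T := H.graph.avgDensity (fun _ _ => K) with hT
  set T' := H.graph.avgDensity (fun _ w a b => if κ w ∈ S then 1 else K a b) with hT'
  have hT0 : 0 ≤ T := H.graph.avgDensity_nonneg fun _ _ => hK
  have hT'0 : 0 ≤ T' := H.graph.avgDensity_nonneg fun _ w a b => by
    split_ifs
    · exact zero_le_one
    · exact hK a b
  -- The label is `true` only at `v₀`, where every edge keeps `K`; elsewhere the edges with color in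
  -- `S` get the constant 1.
  have h := hH.avgDensity_le hκ (A := A) (B := B) (fun v => decide (v = v₀))
    (fun d c a b => if d = false ∧ c ∈ S then 1 else K a b) (fun d c a b => by
      split_ifs
      · exact zero_le_one
      · exact hK a b)
  -- A right vertex with color in `S` retains at most the edge to `v₀`, and its average is then 1 by
  -- `hreg`, just as if that edge were deleted too.
  have hl : H.graph.avgDensity (fun v w a b => if decide (v = v₀) = false ∧ κ w ∈ S then 1
      else K a b) = T' := by
    refine Finset.expect_congr rfl fun x _ => Finset.prod_congr rfl fun w _ => ?_
    by_cases hw : κ w ∈ S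
    · simp only [hw, and_true, if_true, decide_eq_false_iff_not, ite_not, Finset.prod_const_one,
        Fintype.expect_const]
      simp only [Finset.prod_ite_eq']
      split_ifs
      · exact hreg _
      · exact Fintype.expect_const _
    · simp [hw]
  have hr : ∏ u, H.graph.avgDensity (fun _ w a b => if decide (u = v₀) = false ∧ κ w ∈ S then 1
      else K a b) ^ (1 / (Fintype.card V₁ : ℝ)) =
      T ^ (1 / (Fintype.card V₁ : ℝ)) * T' ^ (1 - 1 / (Fintype.card V₁ : ℝ)) := by
    rw [← Finset.mul_prod_erase _ _ (Finset.mem_univ v₀)]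
    congr 1
    · simp [hT]
    · rw [Finset.prod_congr rfl (g := fun _ => T' ^ (1 / (Fintype.card V₁ : ℝ)))
        fun u hu => by simp [hT', Finset.ne_of_mem_erase hu]]
      rw [Finset.prod_const, Finset.card_erase_of_mem (Finset.mem_univ _), Finset.card_univ,
        ← Real.rpow_natCast, ← Real.rpow_mul hT'0, Nat.cast_sub Fintype.card_pos]
      congr 1
      have : (Fintype.card V₁ : ℝ) ≠ 0 := by exact_mod_cast Fintype.card_ne_zero
      field_simp
      simp
  rw [hl, hr] at h
  rcases hT'0.eq_or_lt with h0 | h0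
  · rw [← h0]; exact hT0
  -- Cancelling `T'`, which requires `T' ≠ 0`, leaves `T'^(1/m) ≤ T^(1/m)`.
  · have hm : 0 < 1 / (Fintype.card V₁ : ℝ) := by positivity
    rw [Real.rpow_sub h0, Real.rpow_one, ← mul_div_assoc, le_div_iff₀ (by positivity),
      mul_comm, mul_le_mul_iff_left₀ h0] at h
    exact (Real.rpow_le_rpow_iff hT'0 hT0 hm).1 h

end ColoredBigraph

/-! ### Raising color classes to powers at least one. -/

/-- A tangent-line bound for products of real powers with exponents at least one. -/
theorem Finset.prod_add_sum_le_prod_rpow {ι : Type*} [DecidableEq ι] (s : Finset ι) (G r : ι → ℝ)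
    (hG : ∀ i ∈ s, 0 ≤ G i) (hr : ∀ i ∈ s, 1 ≤ r i) :
    ∏ i ∈ s, G i + ∑ i ∈ s, (r i - 1) * (∏ j ∈ s, G j - ∏ j ∈ s.erase i, G j) ≤
      ∏ i ∈ s, G i ^ r i := by
  by_cases h0 : ∃ i ∈ s, G i = 0
  · have h1 : ∏ i ∈ s, G i = 0 := Finset.prod_eq_zero_iff.2 h0
    have h2 : ∑ i ∈ s, (r i - 1) * (∏ j ∈ s, G j - ∏ j ∈ s.erase i, G j) ≤ 0 := by
      refine Finset.sum_nonpos fun i hi => mul_nonpos_of_nonneg_of_nonpos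
        (sub_nonneg.2 (hr i hi)) ?_
      rw [h1, zero_sub, neg_nonpos]
      exact Finset.prod_nonneg fun j hj => hG j (Finset.mem_of_mem_erase hj)
    have h3 : 0 ≤ ∏ i ∈ s, G i ^ r i :=
      Finset.prod_nonneg fun i hi => Real.rpow_nonneg (hG i hi) _
    linarith
  · push Not at h0
    have hpos : ∀ i ∈ s, 0 < G i := fun i hi => (hG i hi).lt_of_ne' (h0 i hi)
    have hP : 0 < ∏ i ∈ s, G i := Finset.prod_pos hpos
    have e1 : ∏ i ∈ s, G i ^ r i =
        (∏ i ∈ s, G i) * Real.exp (∑ i ∈ s, (r i - 1) * Real.log (G i)) := by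
      rw [Real.exp_sum, ← Finset.prod_mul_distrib]
      refine Finset.prod_congr rfl fun i hi => ?_
      rw [Real.rpow_def_of_pos (hpos i hi)]
      nth_rw 2 [← Real.exp_log (hpos i hi)]
      rw [← Real.exp_add]
      ring_nf
    have e2 := Real.add_one_le_exp (∑ i ∈ s, (r i - 1) * Real.log (G i))
    rw [e1]
    refine le_trans ?_ (mul_le_mul_of_nonneg_left e2 hP.le)
    rw [mul_add, mul_one, add_comm, Finset.mul_sum]
    refine add_le_add (Finset.sum_le_sum fun i hi => ?_) le_rfl
    rw [← Finset.mul_prod_erase s G hi]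
    have hR : 0 < ∏ j ∈ s.erase i, G j :=
      Finset.prod_pos fun j hj => hpos j (Finset.mem_of_mem_erase hj)
    -- Keeping the factor `G i` in front of the logarithm turns the linear term into a difference of
    -- products, with and without `i`.
    have hlog : G i - 1 ≤ G i * Real.log (G i) := by
      have := Real.one_sub_inv_le_log_of_pos (hpos i hi)
      have := mul_le_mul_of_nonneg_left this (hpos i hi).le
      rwa [mul_sub, mul_one, mul_inv_cancel₀ (hpos i hi).ne'] at this
    have := mul_le_mul_of_nonneg_left
      (mul_le_mul_of_nonneg_left hlog hR.le) (sub_nonneg.2 (hr i hi))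
    linarith

namespace ColoredBigraph

-- Averaged over `x`, each correction term of the tangent-line bound is nonnegative because deleting
-- a single color does not increase the density; the main term is at least 1 by deleting all colors.
open scoped BigOperators in
theorem LeftWeaklyHolder.one_le_expect_prod_rpow {V₁ V₂ C : Type*} [Fintype V₁] [Fintype V₂]
    [DecidableEq V₁] [Nonempty V₁] {H : ColoredBigraph V₁ V₂ C} (hH : LeftWeaklyHolder.{u} H)
    {κ : V₂ → C} (hκ : ∀ e : H.graph.E, H.color e = κ e.1.2) {A B : Type u} [Fintype A] [Fintype B]
    [Nonempty A] [Nonempty B] {K : A → B → ℝ} (hK : ∀ a b, 0 ≤ K a b)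
    (hreg : ∀ a, 𝔼 b, K a b = 1) {r : C → ℝ} (hr : ∀ c, 1 ≤ r c) :
    1 ≤ 𝔼 x : V₁ → A, ∏ w, (𝔼 b, ∏ v ∈ H.graph.rightNbhd w, K (x v) b) ^ r (κ w) := by
  classical
  set F : (V₁ → A) → V₂ → ℝ := fun x w => 𝔼 b, ∏ v ∈ H.graph.rightNbhd w, K (x v) b with hF
  have hF0 : ∀ x w, 0 ≤ F x w := fun x w =>
    Finset.expect_nonneg fun _ _ => Finset.prod_nonneg fun _ _ => hK _ _
  set s : Finset C := Finset.univ.image κ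
  have hmem : ∀ w ∈ (Finset.univ : Finset V₂), κ w ∈ s := fun w _ =>
    Finset.mem_image_of_mem κ (Finset.mem_univ w)
  set G : (V₁ → A) → C → ℝ := fun x i => ∏ w with κ w = i, F x w with hG
  have hG0 : ∀ x i, 0 ≤ G x i := fun x i => Finset.prod_nonneg fun _ _ => hF0 _ _
  have hpow (x : V₁ → A) : ∏ w, F x w ^ r (κ w) = ∏ i ∈ s, G x i ^ r i := by
    rw [← Finset.prod_fiberwise_of_maps_to hmem]
    refine Finset.prod_congr rfl fun i _ => ?_
    rw [hG, ← Real.finsetProd_rpow _ _ fun w _ => hF0 x w]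
    exact Finset.prod_congr rfl fun w hw => by rw [(Finset.mem_filter.1 hw).2]
  have hdel (t : Finset C) : 𝔼 x, ∏ i ∈ s \ t, G x i ≤ 𝔼 x, ∏ i ∈ s, G x i := by
    have h := hH.avgDensity_delete_le hκ hK hreg (t : Set C)
    convert h using 1
    · refine Finset.expect_congr rfl fun x _ => ?_
      rw [← Finset.prod_fiberwise_of_maps_to hmem, ← Finset.filter_notMem_eq_sdiff,
        Finset.prod_filter]
      refine Finset.prod_congr rfl fun i _ => ?_
      by_cases hi : i ∈ t
      · rw [if_neg (not_not.2 hi)]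
        refine (Finset.prod_eq_one fun w hw => ?_).symm
        have hw : κ w ∈ t := by rwa [(Finset.mem_filter.1 hw).2]
        simp [hw]
      · rw [if_pos hi]
        refine Finset.prod_congr rfl fun w hw => ?_
        have hw : κ w ∉ t := by rwa [(Finset.mem_filter.1 hw).2]
        simp [hF, hw]
    · refine Finset.expect_congr rfl fun x _ => ?_
      exact Finset.prod_fiberwise_of_maps_to hmem _
  have h1 : 1 ≤ 𝔼 x, ∏ i ∈ s, G x i := by
    simpa [Fintype.expect_const] using hdel s
  calc (1 : ℝ) ≤ 𝔼 x, ∏ i ∈ s, G x i := h1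
    _ ≤ 𝔼 x, (∏ i ∈ s, G x i + ∑ i ∈ s, (r i - 1) * (∏ j ∈ s, G x j - ∏ j ∈ s.erase i, G x j)) := by
      rw [Finset.expect_add_distrib, Finset.expect_sum_comm]
      refine le_add_of_nonneg_right (Finset.sum_nonneg fun i hi => ?_)
      rw [← Finset.mul_expect, Finset.expect_sub_distrib]
      refine mul_nonneg (sub_nonneg.2 (hr i)) (sub_nonneg.2 ?_)
      simpa [Finset.sdiff_singleton_eq_erase] using hdel {i}
    _ ≤ 𝔼 x, ∏ i ∈ s, G x i ^ r i := Finset.expect_le_expect fun x _ =>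
      Finset.prod_add_sum_le_prod_rpow s (G x) r (fun i _ => hG0 x i) fun i _ => hr i
    _ = _ := Finset.expect_congr rfl fun x _ => (hpow x).symm

/-! ### Automorphisms and orbit sums. -/

variable {V₁ V₂ C : Type*}

theorem IsAut.mul {H : ColoredBigraph V₁ V₂ C} {σ τ : Equiv.Perm V₁ × Equiv.Perm V₂}
    (hσ : H.IsAut σ) (hτ : H.IsAut τ) : H.IsAut (σ * τ) := by
  refine ⟨fun v w => (hτ.1 v w).trans (hσ.1 _ _), fun e e' h => ?_⟩
  have h1 : (τ.1 e.1.1, τ.2 e.1.2) ∈ H.graph.E := (hτ.1 _ _).1 e.2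
  exact (hτ.2 e ⟨_, h1⟩ rfl).trans (hσ.2 ⟨_, h1⟩ e' h)

theorem IsAut.inv {H : ColoredBigraph V₁ V₂ C} {σ : Equiv.Perm V₁ × Equiv.Perm V₂}
    (hσ : H.IsAut σ) : H.IsAut σ⁻¹ := by
  refine ⟨fun v w => ?_, fun e e' h => (hσ.2 e' e ?_).symm⟩
  · rw [hσ.1 (σ⁻¹.1 v) (σ⁻¹.2 w)]
    simp
  · rw [h]
    simp

theorem mem_Aut [Fintype V₁] [Fintype V₂] {H : ColoredBigraph V₁ V₂ C}
    {σ : Equiv.Perm V₁ × Equiv.Perm V₂} :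
    σ ∈ H.Aut ↔ H.IsAut σ := by
  simp [Aut]

theorem IsAut.rightNbhd_apply [Fintype V₁] {H : ColoredBigraph V₁ V₂ C}
    {σ : Equiv.Perm V₁ × Equiv.Perm V₂}
    (hσ : H.IsAut σ) (w : V₂) :
    H.graph.rightNbhd (σ.2 w) = (H.graph.rightNbhd w).map σ.1.toEmbedding := by
  ext v
  obtain ⟨v, rfl⟩ := σ.1.surjective v
  rw [Bigraph.mem_rightNbhd, ← hσ.1, ← Bigraph.mem_rightNbhd]
  simp

theorem IsAut.nbhdCount_map [Fintype V₁] [Fintype V₂] {H : ColoredBigraph V₁ V₂ C}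
    {σ : Equiv.Perm V₁ × Equiv.Perm V₂}
    (hσ : H.IsAut σ) (U : Finset V₁) :
    H.graph.nbhdCount (U.map σ.1.toEmbedding) = H.graph.nbhdCount U := by
  refine (Finset.card_equiv σ.2 fun w => ?_).symm
  simp [hσ.rightNbhd_apply]

theorem IsAut.orbitSum_map [Fintype V₁] [Fintype V₂] {H : ColoredBigraph V₁ V₂ C} {V₂' : Type*}
    [Fintype V₂']
    {τ : Equiv.Perm V₁ × Equiv.Perm V₂} (hτ : H.IsAut τ) (G : Bigraph V₁ V₂') (U : Finset V₁) :
    H.orbitSum G (U.map τ.1.toEmbedding) = H.orbitSum G U := by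
  refine Finset.sum_equiv (Equiv.mulRight τ) (fun σ => ?_) fun σ _ => ?_
  · simp only [mem_Aut, Equiv.coe_mulRight]
    exact ⟨fun h => h.mul hτ, fun h => by simpa using h.mul hτ.inv⟩
  · rw [Finset.map_map]
    rfl

theorem orbitSum_graph [Fintype V₁] [Fintype V₂] (H : ColoredBigraph V₁ V₂ C) (U : Finset V₁) :
    H.orbitSum H.graph U = H.Aut.card * H.graph.nbhdCount U := by
  rw [orbitSum, Finset.sum_congr rfl fun σ hσ => (mem_Aut.1 hσ).nbhdCount_map U, Finset.sum_const,
    smul_eq_mul]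

theorem Aut_nonempty [Fintype V₁] [Fintype V₂] (H : ColoredBigraph V₁ V₂ C) : H.Aut.Nonempty :=
  ⟨1, mem_Aut.2 ⟨fun _ _ => Iff.rfl, fun _ _ h => congrArg _ (Subtype.ext h.symm)⟩⟩

/-- Every right vertex lies on an edge, whose color is its own, so transitivity on edges passes to
right vertices of equal color. -/
theorem ColorEdgeTransitive.exists_isAut {H : ColoredBigraph V₁ V₂ C}
    (hH : H.ColorEdgeTransitive) (hiso : H.graph.NoIsolated) {κ : V₂ → C}
    (hκ : ∀ e : H.graph.E, H.color e = κ e.1.2) {w w' : V₂} (h : κ w = κ w') :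
    ∃ σ, H.IsAut σ ∧ σ.2 w = w' := by
  obtain ⟨v, hv⟩ := hiso.2 w
  obtain ⟨v', hv'⟩ := hiso.2 w'
  obtain ⟨σ, hσ, -, h2⟩ := hH ⟨_, hv⟩ ⟨_, hv'⟩ (by rw [hκ, hκ]; exact h)
  exact ⟨σ, hσ, h2⟩

end ColoredBigraph

/-! ### Comparing `G` with `H` by averaging over automorphisms. -/

namespace Bigraph

theorem prod_rightNbhd {V₁ V₂ : Type*} [Fintype V₁] [Fintype V₂] (G : Bigraph V₁ V₂)
    (F : Finset V₁ → ℝ) : ∏ w, F (G.rightNbhd w) = ∏ U, F U ^ G.nbhdCount U := by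
  classical
  rw [← Finset.prod_fiberwise (Finset.univ : Finset V₂) G.rightNbhd]
  refine Finset.prod_congr rfl fun U _ => ?_
  rw [Finset.prod_congr rfl fun w hw => by rw [(Finset.mem_filter.1 hw).2], Finset.prod_const,
    nbhdCount]

open scoped BigOperators in
/-- The density is unchanged when the left vertices are permuted. -/
theorem avgDensity_eq_expect_map {V₁ V₂ A B : Type*} [Fintype V₁] [DecidableEq V₁] [Fintype V₂]
    [Fintype A] [Fintype B] (G : Bigraph V₁ V₂) (K : A → B → ℝ) (σ : Equiv.Perm V₁) :
    G.avgDensity (fun _ _ => K) = 𝔼 x : V₁ → A, ∏ U,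
      (𝔼 b, ∏ v ∈ U, K (x v) b) ^ G.nbhdCount (U.map σ.toEmbedding) := by
  refine Fintype.expect_equiv (σ.symm.arrowCongr (Equiv.refl A)) _ _ fun x => ?_
  rw [prod_rightNbhd G fun U => 𝔼 b, ∏ v ∈ U, K (x v) b, ← σ.finsetCongr.prod_comp]
  refine Finset.prod_congr rfl fun U _ => ?_
  simp

-- AM-GM over `Aut(H)`: every automorphism rewrites the same density with permuted exponents, and
-- the geometric mean averages these exponents.
open scoped BigOperators in
theorem expect_prod_rpow_le_avgDensity {V₁ V₂ V₂' C A B : Type*} [Fintype V₁] [DecidableEq V₁]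
    [Fintype V₂] [Fintype V₂'] [Fintype A] [Fintype B] (H : ColoredBigraph V₁ V₂ C)
    (G : Bigraph V₁ V₂') {K : A → B → ℝ} (hK : ∀ a b, 0 ≤ K a b) :
    𝔼 x : V₁ → A, ∏ U, (𝔼 b, ∏ v ∈ U, K (x v) b) ^ ((H.orbitSum G U : ℝ) / H.Aut.card) ≤
      G.avgDensity (fun _ _ => K) := by
  have hn : (H.Aut.card : ℝ) ≠ 0 := by exact_mod_cast H.Aut_nonempty.card_pos.ne'
  have hF : ∀ (x : V₁ → A) (U : Finset V₁), 0 ≤ 𝔼 b, ∏ v ∈ U, K (x v) b := fun x U =>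
    Finset.expect_nonneg fun _ _ => Finset.prod_nonneg fun _ _ => hK _ _
  calc _ ≤ 𝔼 x : V₁ → A, ∑ σ ∈ H.Aut, (1 / H.Aut.card : ℝ) * ∏ U,
        (𝔼 b, ∏ v ∈ U, K (x v) b) ^ G.nbhdCount (U.map σ.1.toEmbedding) := by
        refine Finset.expect_le_expect fun x _ => ?_
        refine le_trans (le_of_eq ?_) (Real.geom_mean_le_arith_mean_weighted H.Aut
          (fun _ => (1 / H.Aut.card : ℝ)) _ (fun _ _ => by positivity) (by simp [hn])
          fun σ _ => Finset.prod_nonneg fun U _ => pow_nonneg (hF x U) _)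
        rw [Real.finsetProd_rpow _ _ fun σ _ => Finset.prod_nonneg fun U _ =>
          pow_nonneg (hF x U) _, Finset.prod_comm, ← Real.finsetProd_rpow _ _ fun U _ =>
          Finset.prod_nonneg fun σ _ => pow_nonneg (hF x U) _]
        refine Finset.prod_congr rfl fun U _ => ?_
        rw [Finset.prod_pow_eq_pow_sum, ← Real.rpow_natCast, ← Real.rpow_mul (hF x U),
          ColoredBigraph.orbitSum, mul_one_div]
    _ = G.avgDensity (fun _ _ => K) := by
        rw [Finset.expect_sum_comm, Finset.sum_congr rfl fun σ _ => by
          rw [← Finset.mul_expect, ← G.avgDensity_eq_expect_map K σ.1]]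
        rw [Finset.sum_const, nsmul_eq_mul, ← mul_assoc, mul_one_div_cancel hn, one_mul]

/-- A bigraph is Sidorenko for finite kernels that are regular on the left. -/
def LeftRegularSidorenko.{a, b, c} {V₁ : Type b} {V₂ : Type c} [Fintype V₁] [Fintype V₂]
    [DecidableEq V₁] (G : Bigraph V₁ V₂) : Prop :=
  ∀ (A B : Type a) [Fintype A] [Fintype B] [Nonempty A] [Nonempty B] (K : A → B → ℝ),
    (∀ a b, 0 ≤ K a b) → (∀ a, Finset.expect Finset.univ (K a) = 1) →
      1 ≤ G.avgDensity (fun _ _ => K)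

open scoped BigOperators in
theorem leftRegularSidorenko_of_orbitSum {V₁ V₂ V₂' C : Type*} [Fintype V₁] [Fintype V₂]
    [DecidableEq V₁] [Nonempty V₁] [Fintype V₂'] {H : ColoredBigraph V₁ V₂ C}
    (hiso : H.graph.NoIsolated) (huni : H.RightUniform) (htrans : H.ColorEdgeTransitive)
    (hH : ColoredBigraph.LeftWeaklyHolder.{u} H) (G : Bigraph V₁ V₂')
    (h0 : ∀ U : Finset V₁, 2 ≤ U.card → (H.orbitSum G U = 0 ↔ H.orbitSum H.graph U = 0))
    (hle : ∀ U : Finset V₁, 2 ≤ U.card → H.orbitSum H.graph U ≤ H.orbitSum G U) :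
    LeftRegularSidorenko.{u} G := by
  classical
  intro A B _ _ _ _ K hK hreg
  obtain ⟨κ, hκ⟩ := huni
  have hn : (H.Aut.card : ℝ) ≠ 0 := by exact_mod_cast H.Aut_nonempty.card_pos.ne'
  have hratio : ∀ w w', κ w = κ w' → (H.graph.rightNbhd w).card = (H.graph.rightNbhd w').card ∧
      H.orbitSum G (H.graph.rightNbhd w) = H.orbitSum G (H.graph.rightNbhd w') ∧
      H.orbitSum H.graph (H.graph.rightNbhd w) = H.orbitSum H.graph (H.graph.rightNbhd w') := by
    intro w w' h
    obtain ⟨σ, hσ, rfl⟩ := htrans.exists_isAut hiso hκ h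
    rw [hσ.rightNbhd_apply, hσ.orbitSum_map, hσ.orbitSum_map, Finset.card_map]
    exact ⟨rfl, rfl, rfl⟩
  -- For neighborhoods with fewer than two vertices the hypotheses say nothing, but the factor is 1
  -- by regularity, so any exponent at least 1 serves.
  let ρ : V₂ → ℝ := fun w => if 2 ≤ (H.graph.rightNbhd w).card then
    (H.orbitSum G (H.graph.rightNbhd w) : ℝ) / H.orbitSum H.graph (H.graph.rightNbhd w) else 1
  have hρ : ∀ w w', κ w = κ w' → ρ w = ρ w' := fun w w' h => by
    obtain ⟨h1, h2, h3⟩ := hratio w w' h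
    simp only [ρ, h1, h2, h3]
  -- By `hρ` the ratio descends to colors, so any right vertex of the color may represent it; unused
  -- colors get 1.
  let r : C → ℝ := fun c => if h : ∃ w, κ w = c then ρ h.choose else 1
  have hr : ∀ w, r (κ w) = ρ w := fun w => by
    have h : ∃ w', κ w' = κ w := ⟨w, rfl⟩
    simp only [r, dif_pos h]
    exact hρ _ _ h.choose_spec
  have hρ1 : ∀ w, 1 ≤ ρ w := fun w => by
    simp only [ρ]
    split_ifs with hw
    · have hd : 0 < H.graph.nbhdCount (H.graph.rightNbhd w) :=
        Finset.card_pos.2 ⟨w, by simp⟩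
      have : 0 < H.orbitSum H.graph (H.graph.rightNbhd w) := by
        rw [H.orbitSum_graph]
        exact Nat.mul_pos H.Aut_nonempty.card_pos hd
      rw [one_le_div (by exact_mod_cast this)]
      exact_mod_cast hle _ hw
    · exact le_rfl
  have hr1 : ∀ c, 1 ≤ r c := fun c => by
    simp only [r]
    split_ifs
    · exact hρ1 _
    · exact le_rfl
  refine (hH.one_le_expect_prod_rpow hκ hK hreg hr1).trans (le_trans (le_of_eq ?_)
    (expect_prod_rpow_le_avgDensity H G hK))
  refine Finset.expect_congr rfl fun x _ => ?_
  rw [← Finset.prod_fiberwise (Finset.univ : Finset V₂) H.graph.rightNbhd]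
  refine Finset.prod_congr rfl fun U _ => ?_
  have hF : 0 ≤ 𝔼 b, ∏ v ∈ U, K (x v) b :=
    Finset.expect_nonneg fun _ _ => Finset.prod_nonneg fun _ _ => hK _ _
  rcases Nat.lt_or_ge U.card 2 with hU | hU
  · have h1 : 𝔼 b, ∏ v ∈ U, K (x v) b = 1 := by
      rcases Nat.lt_or_ge U.card 1 with h | h
      · have : U = ∅ := Finset.card_eq_zero.1 (by omega)
        simp [this]
      · obtain ⟨v, rfl⟩ := Finset.card_eq_one.1 (by omega : U.card = 1)
        simpa using hreg (x v)
    rw [h1, Real.one_rpow]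
    refine Finset.prod_eq_one fun w hw => ?_
    rw [(Finset.mem_filter.1 hw).2, h1, Real.one_rpow]
  · have hterm : ∀ w ∈ Finset.univ.filter (fun w => H.graph.rightNbhd w = U),
        (𝔼 b, ∏ v ∈ H.graph.rightNbhd w, K (x v) b) ^ r (κ w) =
          (𝔼 b, ∏ v ∈ U, K (x v) b) ^ ((H.orbitSum G U : ℝ) / H.orbitSum H.graph U) := by
      intro w hw
      have hw := (Finset.mem_filter.1 hw).2
      rw [hr]
      simp only [ρ, hw, if_pos hU]
    rw [Finset.prod_congr rfl hterm, Finset.prod_const, ← Real.rpow_natCast, ← Real.rpow_mul hF]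
    have hc : (Finset.univ.filter (fun w => H.graph.rightNbhd w = U)).card =
        H.graph.nbhdCount U := by
      rw [nbhdCount]; congr!
    rw [hc]
    congr 1
    have hO := H.orbitSum_graph U
    rcases Nat.eq_zero_or_pos (H.graph.nbhdCount U) with hd | hd
    -- Here `H` contributes no factor for `U`; the first hypothesis ensures that the averaged
    -- exponent for `G` vanishes as well.
    · have : H.orbitSum G U = 0 := (h0 U hU).2 (by rw [hO, hd, mul_zero])
      simp [this]
    · rw [hO]
      have : (H.graph.nbhdCount U : ℝ) ≠ 0 := by exact_mod_cast hd.ne'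
      push_cast
      field_simp

end Bigraph

/-! ### Words and their orbits under permuting positions. -/

theorem exists_perm_of_card_fiber_eq {ι P : Type*} [Fintype ι] [DecidableEq P] {z z' : ι → P}
    (h : ∀ p, (Finset.univ.filter fun k => z k = p).card =
      (Finset.univ.filter fun k => z' k = p).card) : ∃ π : Equiv.Perm ι, z = z' ∘ π := by
  have e : ∀ p, Nonempty ({k // z k = p} ≃ {k // z' k = p}) := fun p =>
    ⟨Fintype.equivOfCardEq (by rw [Fintype.card_subtype, Fintype.card_subtype, h p])⟩
  exact ⟨Equiv.ofFiberEquiv fun p => (e p).some, funext fun k =>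
    (Equiv.ofFiberEquiv_map (fun p => (e p).some) k).symm⟩

/-- The orbit of a word under permutation of its positions. -/
def WordOrbit {n : ℕ} {X : Type u} (x₀ : Fin n → X) : Type u :=
  {x : Fin n → X // ∃ π : Equiv.Perm (Fin n), x = x₀ ∘ π}

namespace WordOrbit

variable {n : ℕ} {X : Type u} {x₀ : Fin n → X}

noncomputable instance [Fintype X] : Fintype (WordOrbit x₀) :=
  @Fintype.ofFinite _ (Subtype.finite (p := fun x => ∃ π : Equiv.Perm (Fin n), x = x₀ ∘ π))

instance : Nonempty (WordOrbit x₀) := ⟨⟨x₀, 1, rfl⟩⟩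

theorem card_le [Fintype X] : Fintype.card (WordOrbit x₀) ≤ Fintype.card X ^ n := by
  refine (Fintype.card_le_of_injective (fun a : WordOrbit x₀ => a.1)
    Subtype.val_injective).trans ?_
  simp

end WordOrbit

/-- A permutation-invariant sum over words is dominated by a single orbit, up to a factor which is
polynomial in the length. -/
theorem exists_orbit_sum_le {P : Type u} [Fintype P] [Nonempty P] (n : ℕ) (Φ : (Fin n → P) → ℝ)
    (hΦ : ∀ z, 0 ≤ Φ z) (hperm : ∀ z (π : Equiv.Perm (Fin n)), Φ (z ∘ π) = Φ z) :
    ∃ z₀, ∑ z, Φ z ≤ ((n : ℝ) + 1) ^ Fintype.card P *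
      (Fintype.card (WordOrbit z₀) * Φ z₀) := by
  classical
  obtain ⟨z₀, -, hz₀⟩ := Finset.exists_max_image (Finset.univ : Finset (Fin n → P))
    (fun z₀ => (Fintype.card (WordOrbit z₀) : ℝ) * Φ z₀) Finset.univ_nonempty
  refine ⟨z₀, ?_⟩
  -- The type of a word records how often each letter occurs. There are at most `(n+1)^|P|` types,
  -- and words of one type form part of one orbit.
  let τ : (Fin n → P) → (P → Fin (n + 1)) := fun z p =>
    ⟨(Finset.univ.filter fun k => z k = p).card, Nat.lt_succ_of_le (by
      simpa using Finset.card_le_univ (Finset.univ.filter fun k => z k = p))⟩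
  rw [← Finset.sum_fiberwise Finset.univ τ]
  refine (Finset.sum_le_card_nsmul _ _ _ fun t _ => ?_).trans_eq (b := (Finset.univ :
    Finset (P → Fin (n + 1))).card • ((Fintype.card (WordOrbit z₀) : ℝ) * Φ z₀)) (by simp)
  rcases (Finset.univ.filter fun z => τ z = t).eq_empty_or_nonempty with h | ⟨z₁, h₁⟩
  · rw [h, Finset.sum_empty]
    exact mul_nonneg (Nat.cast_nonneg _) (hΦ _)
  · refine le_trans ?_ (hz₀ z₁ (Finset.mem_univ _))
    have hsub : ∀ z ∈ Finset.univ.filter (fun z => τ z = t),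
        ∃ π : Equiv.Perm (Fin n), z = z₁ ∘ π := fun z hz =>
      exists_perm_of_card_fiber_eq fun p => by
        have h2 := ((Finset.mem_filter.1 hz).2).trans (Finset.mem_filter.1 h₁).2.symm
        simpa [τ] using congrFun h2 p
    rw [← nsmul_eq_mul]
    refine (Finset.sum_le_card_nsmul _ _ (Φ z₁) fun z hz => ?_).trans ?_
    · obtain ⟨π, rfl⟩ := hsub z hz
      exact (hperm _ _).le
    · refine nsmul_le_nsmul_left (hΦ _) ?_
      rw [← Fintype.card_coe]
      exact Fintype.card_le_of_injective (fun z => (⟨z.1, hsub z.1 z.2⟩ : WordOrbit z₁))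
        fun z z' h => Subtype.ext (congrArg (fun a : WordOrbit z₁ => a.1) h)

/-- Exponential growth is not compensated by polynomial factors. -/
theorem le_of_pow_le_poly_mul_pow {a b : ℝ} (hb : 0 ≤ b) (c : ℕ)
    (h : ∀ n : ℕ, a ^ n ≤ ((n : ℝ) + 1) ^ c * b ^ n) : a ≤ b := by
  by_contra! hab
  rcases hb.eq_or_lt with rfl | hb
  · have := h 1
    simp at this
    linarith
  have hr : 1 < a / b := (one_lt_div hb).2 hab
  -- The shift matches the polynomial `(n+1)^c`; comparing with `b / a` rather than 1 absorbs the
  -- extra factor of the exponent `n+1`.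
  have ht := (tendsto_pow_const_div_const_pow_of_one_lt c hr).comp (Filter.tendsto_add_atTop_nat 1)
  have hlt := ht.eventually (gt_mem_nhds (show (0 : ℝ) < b / a by
    exact div_pos hb (hb.trans hab)))
  obtain ⟨n, hn⟩ := hlt.exists
  have ha : 0 < a := hb.trans hab
  have h1 := h n
  simp only [Function.comp_apply, Nat.cast_add, Nat.cast_one] at hn
  rw [div_lt_iff₀ (by positivity), pow_succ, mul_comm (_ ^ n), ← mul_assoc,
    div_mul_div_cancel₀ ha.ne', div_self hb.ne', one_mul, div_pow,
    lt_div_iff₀ (by positivity)] at hn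
  linarith

namespace Bigraph

/-- Scaling `K` by `|B|/s` makes its row averages 1; clearing the normalizations gives a form suited
to counting. -/
theorem LeftRegularSidorenko.le_sum {V₁ V₂ : Type*} [Fintype V₁] [Fintype V₂]
    [DecidableEq V₁] [DecidableEq V₂] {G : Bigraph V₁ V₂} (hG : LeftRegularSidorenko.{u} G)
    {A B : Type u} [Fintype A] [Fintype B]
    [Nonempty A] [Nonempty B] {K : A → B → ℝ} (hK : ∀ a b, 0 ≤ K a b) {s : ℝ} (hs : 0 < s)
    (hreg : ∀ a, ∑ b, K a b = s) :
    (Fintype.card A : ℝ) ^ Fintype.card V₁ * (Fintype.card B : ℝ) ^ Fintype.card V₂ *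
      (s / Fintype.card B) ^ G.E.card ≤
      ∑ x : V₁ → A, ∑ y : V₂ → B, ∏ e ∈ G.E, K (x e.1) (y e.2) := by
  have hB : (0 : ℝ) < Fintype.card B := by exact_mod_cast Fintype.card_pos
  have hA : (0 : ℝ) < Fintype.card A := by exact_mod_cast Fintype.card_pos
  have h := hG A B (fun a b => Fintype.card B / s * K a b)
    (fun a b => mul_nonneg (div_nonneg hB.le hs.le) (hK a b)) fun a => by
      rw [← Finset.mul_expect, Fintype.expect_eq_sum_div_card, hreg]
      field_simp
  rw [← expect_edges] at h
  simp only [Finset.prod_mul_distrib, Finset.prod_const, ← Finset.mul_expect,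
    Fintype.expect_eq_sum_div_card, Fintype.card_fun, Nat.cast_pow, ← Finset.sum_div] at h
  rw [div_div, ← mul_div_assoc, one_le_div (by positivity)] at h
  have h2 := mul_le_mul_of_nonneg_left h (pow_nonneg (div_nonneg hs.le hB.le) G.E.card)
  rw [← mul_assoc _ (_ ^ G.E.card), ← mul_pow, div_mul_div_cancel₀ hB.ne', div_self hs.ne',
    one_pow, one_mul] at h2
  linarith

end Bigraph

namespace WordOrbit

variable {n : ℕ} {X : Type u} {x₀ : Fin n → X}

theorem prod_eq (a : WordOrbit x₀) (h : X → ℝ) : ∏ k, h (a.1 k) = ∏ k, h (x₀ k) := by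
  obtain ⟨_, π, rfl⟩ := a
  exact Equiv.prod_comp π fun k => h (x₀ k)

/-- Permuting the positions of the words in an orbit. -/
def permute (π : Equiv.Perm (Fin n)) : WordOrbit x₀ ≃ WordOrbit x₀ where
  toFun a := ⟨a.1 ∘ π, a.2.choose * π, by
    conv_lhs => rw [a.2.choose_spec]
    rfl⟩
  invFun a := ⟨a.1 ∘ π.symm, a.2.choose * π.symm, by
    conv_lhs => rw [a.2.choose_spec]
    rfl⟩
  left_inv a := Subtype.ext (by ext; simp)
  right_inv a := Subtype.ext (by ext; simp)

open scoped Classical in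
/-- The indicator of the orbit of `z₀` between its two projections. -/
noncomputable def kernel {Y : Type u} (z₀ : Fin n → X × Y) (a : WordOrbit (Prod.fst ∘ z₀))
    (b : WordOrbit (Prod.snd ∘ z₀)) : ℝ :=
  if ∃ π : Equiv.Perm (Fin n), (fun k => (a.1 k, b.1 k)) = z₀ ∘ π then 1 else 0

theorem kernel_nonneg {Y : Type u} (z₀ : Fin n → X × Y) (a : WordOrbit (Prod.fst ∘ z₀))
    (b : WordOrbit (Prod.snd ∘ z₀)) : 0 ≤ kernel z₀ a b := by
  unfold kernel
  split_ifs <;> norm_num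

theorem kernel_permute {Y : Type u} (z₀ : Fin n → X × Y) (a : WordOrbit (Prod.fst ∘ z₀))
    (b : WordOrbit (Prod.snd ∘ z₀)) (π : Equiv.Perm (Fin n)) :
    kernel z₀ (permute π a) (permute π b) = kernel z₀ a b := by
  unfold kernel
  congr 1
  refine propext ⟨fun ⟨ρ, h⟩ => ⟨ρ * π⁻¹, funext fun k => ?_⟩, fun ⟨ρ, h⟩ =>
    ⟨ρ * π, funext fun k => congrFun h (π k)⟩⟩
  have hk : (a.1 (π (π.symm k)), b.1 (π (π.symm k))) = z₀ (ρ (π.symm k)) := congrFun h (π.symm k)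
  rwa [Equiv.apply_symm_apply] at hk

/-- Permutations of positions act transitively on the left orbit and preserve the kernel, whence
left-regularity. -/
theorem sum_kernel_eq [Fintype X] {Y : Type u} [Fintype Y] (z₀ : Fin n → X × Y)
    (a : WordOrbit (Prod.fst ∘ z₀)) :
    ∑ b, kernel z₀ a b = ∑ b, kernel z₀ ⟨Prod.fst ∘ z₀, 1, rfl⟩ b := by
  obtain ⟨π, hπ⟩ := a.2
  have ha : a = permute π ⟨Prod.fst ∘ z₀, 1, rfl⟩ := Subtype.ext hπ
  rw [ha, ← Equiv.sum_comp (permute π)]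
  exact Finset.sum_congr rfl fun b _ => kernel_permute z₀ _ b π

theorem sum_kernel_pos [Fintype X] {Y : Type u} [Fintype Y] (z₀ : Fin n → X × Y) :
    0 < ∑ b, kernel z₀ ⟨Prod.fst ∘ z₀, 1, rfl⟩ b := by
  refine Finset.sum_pos' (fun b _ => kernel_nonneg _ _ _)
    ⟨⟨Prod.snd ∘ z₀, 1, rfl⟩, Finset.mem_univ _, ?_⟩
  unfold kernel
  rw [if_pos ⟨1, rfl⟩]
  exact one_pos

/-- A word of pairs is determined by its two projections, so the orbit embeds in the support of the
kernel, whose size is the number of rows times the common row sum. -/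
theorem card_prod_le [Fintype X] {Y : Type u} [Fintype Y] (z₀ : Fin n → X × Y) :
    (Fintype.card (WordOrbit z₀) : ℝ) ≤ Fintype.card (WordOrbit (Prod.fst ∘ z₀)) *
        ∑ b, kernel z₀ ⟨Prod.fst ∘ z₀, 1, rfl⟩ b := by
  rw [← nsmul_eq_mul, ← Finset.card_univ (α := WordOrbit (Prod.fst ∘ z₀)), ← Finset.sum_const,
    ← Finset.sum_congr rfl fun a _ => sum_kernel_eq z₀ a, ← Fintype.sum_prod_type']
  simp only [kernel]
  rw [Finset.sum_boole, Nat.cast_le, ← Finset.card_univ]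
  have hfst (z : WordOrbit z₀) : ∃ π : Equiv.Perm (Fin n),
      Prod.fst ∘ z.1 = (Prod.fst ∘ z₀) ∘ π := z.2.imp fun π h => by rw [h]; rfl
  have hsnd (z : WordOrbit z₀) : ∃ π : Equiv.Perm (Fin n),
      Prod.snd ∘ z.1 = (Prod.snd ∘ z₀) ∘ π := z.2.imp fun π h => by rw [h]; rfl
  refine Finset.card_le_card_of_injOn (fun z => (⟨_, hfst z⟩, ⟨_, hsnd z⟩)) (fun z _ => ?_)
    fun z _ z' _ h => Subtype.ext (funext fun k => ?_)
  · simp only [Finset.coe_filter, Finset.mem_univ, true_and, Set.mem_ofPred_eq]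
    exact z.2
  · have h1 := congrFun (congrArg (fun p => p.1.1) h) k
    have h2 := congrFun (congrArg (fun p => p.2.1) h) k
    exact Prod.ext h1 h2

end WordOrbit

theorem sum_le_sum_pow_of_injective {P Q : Type*} [Fintype P] [Fintype Q] {n : ℕ}
    {ι : P → Fin n → Q} (hι : Function.Injective ι) {T : Q → ℝ} (hT : ∀ q, 0 ≤ T q) {h : P → ℝ}
    (hle : ∀ p, h p ≤ ∏ k, T (ι p k)) : ∑ p, h p ≤ (∑ q, T q) ^ n := by
  classical
  rw [Fintype.sum_pow]
  refine (Finset.sum_le_sum fun p _ => hle p).trans ?_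
  rw [← Finset.sum_image (s := Finset.univ) (g := ι) (f := fun p => ∏ k, T (p k)) hι.injOn]
  exact Finset.sum_le_univ_sum_of_nonneg fun p => Finset.prod_nonneg fun k _ => hT _

/-! ### The tensor-power argument for weighted finite sums. -/

namespace Bigraph

theorem NoIsolated.card_left_le {V₁ V₂ : Type*} [Fintype V₁] [Fintype V₂] {G : Bigraph V₁ V₂}
    (hG : G.NoIsolated) : Fintype.card V₁ ≤ G.E.card := by
  choose w hw using hG.1
  rw [← Finset.card_univ]
  exact Finset.card_le_card_of_injOn (fun v => (v, w v)) (fun v _ => hw v)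
    fun v _ v' _ h => congrArg Prod.fst h

theorem NoIsolated.card_right_le {V₁ V₂ : Type*} [Fintype V₁] [Fintype V₂] {G : Bigraph V₁ V₂}
    (hG : G.NoIsolated) : Fintype.card V₂ ≤ G.E.card := by
  choose v hv using hG.2
  rw [← Finset.card_univ]
  exact Finset.card_le_card_of_injOn (fun w => (v w, w)) (fun w _ => hv w)
    fun w _ w' _ h => congrArg Prod.snd h

/-- The summand of the weighted homomorphism sum of `G`. -/
def homWeight {V₁ V₂ X Y : Type*} [Fintype V₁] [Fintype V₂] (G : Bigraph V₁ V₂)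
    (f : V₁ → X → ℝ) (g : V₂ → Y → ℝ) (W : X × Y → ℝ) (q : (V₁ → X) × (V₂ → Y)) : ℝ :=
  (∏ v, f v (q.1 v)) * (∏ w, g w (q.2 w)) * ∏ e ∈ G.E, W (q.1 e.1, q.2 e.2)

theorem homWeight_nonneg {V₁ V₂ X Y : Type*} [Fintype V₁] [Fintype V₂] (G : Bigraph V₁ V₂)
    {f : V₁ → X → ℝ} {g : V₂ → Y → ℝ} {W : X × Y → ℝ} (hf : ∀ v x, 0 ≤ f v x)
    (hg : ∀ w y, 0 ≤ g w y) (hW : ∀ p, 0 ≤ W p) (q : (V₁ → X) × (V₂ → Y)) :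
    0 ≤ G.homWeight f g W q :=
  mul_nonneg (mul_nonneg (Finset.prod_nonneg fun _ _ => hf _ _)
    (Finset.prod_nonneg fun _ _ => hg _ _)) (Finset.prod_nonneg fun _ _ => hW _)

/-- The power `|E|` splits into all vertex weights and one `W`-product per edge. Products of letter
weights are constant on an orbit, so those of `z₀` can be replaced by those of `p`. At an edge,
either the kernel is 0 or the two words together rearrange `z₀` and give the same `W`-product. -/
theorem prod_kernel_le_prod_homWeight {V₁ V₂ : Type*} {X Y : Type u} [Fintype V₁] [Fintype V₂]
    (G : Bigraph V₁ V₂)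
    {f : V₁ → X → ℝ} {g : V₂ → Y → ℝ} {W : X × Y → ℝ} (hf : ∀ v x, 0 ≤ f v x)
    (hg : ∀ w y, 0 ≤ g w y) (hW : ∀ p, 0 ≤ W p) {F : X → ℝ} {F' : Y → ℝ}
    (hF : ∀ x, F x ^ G.E.card = ∏ v, f v x) (hF' : ∀ y, F' y ^ G.E.card = ∏ w, g w y)
    {n : ℕ} (z₀ : Fin n → X × Y)
    (p : (V₁ → WordOrbit (Prod.fst ∘ z₀)) × (V₂ → WordOrbit (Prod.snd ∘ z₀))) :
    (∏ k, F (z₀ k).1 * F' (z₀ k).2 * W (z₀ k)) ^ G.E.card *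
        ∏ e ∈ G.E, WordOrbit.kernel z₀ (p.1 e.1) (p.2 e.2) ≤
      ∏ k, G.homWeight f g W (fun v => (p.1 v).1 k, fun w => (p.2 w).1 k) := by
  have hl : (∏ k, F (z₀ k).1 * F' (z₀ k).2 * W (z₀ k)) ^ G.E.card =
      (∏ v, ∏ k, f v ((p.1 v).1 k)) * (∏ w, ∏ k, g w ((p.2 w).1 k)) *
        ∏ e ∈ G.E, ∏ k, W (z₀ k) := by
    rw [← Finset.prod_pow]
    simp only [mul_pow, hF, hF', Finset.prod_mul_distrib]
    rw [Finset.prod_comm, Finset.prod_comm (f := fun k w => g w (z₀ k).2), Finset.prod_const,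
      Finset.prod_pow]
    congr 2
    · exact Finset.prod_congr rfl fun v _ => ((p.1 v).prod_eq (f v)).symm
    · exact Finset.prod_congr rfl fun w _ => ((p.2 w).prod_eq (g w)).symm
  have hr : ∏ k, G.homWeight f g W (fun v => (p.1 v).1 k, fun w => (p.2 w).1 k) =
      (∏ v, ∏ k, f v ((p.1 v).1 k)) * (∏ w, ∏ k, g w ((p.2 w).1 k)) *
        ∏ e ∈ G.E, ∏ k, W ((p.1 e.1).1 k, (p.2 e.2).1 k) := by
    simp only [homWeight, Finset.prod_mul_distrib]
    rw [Finset.prod_comm, Finset.prod_comm (f := fun k w => g w ((p.2 w).1 k)),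
      Finset.prod_comm (t := G.E)]
  rw [hl, hr, mul_assoc, ← Finset.prod_mul_distrib]
  refine mul_le_mul_of_nonneg_left (Finset.prod_le_prod (fun e _ => ?_) fun e _ => ?_) ?_
  · exact mul_nonneg (Finset.prod_nonneg fun k _ => hW _) (WordOrbit.kernel_nonneg _ _ _)
  · unfold WordOrbit.kernel
    split_ifs with h
    · obtain ⟨π, hπ⟩ := h
      rw [mul_one, ← Equiv.prod_comp π]
      exact (Finset.prod_congr rfl fun k _ => congrArg W (congrFun hπ k).symm).le
    · rw [mul_zero]
      exact Finset.prod_nonneg fun k _ => hW _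
  · exact mul_nonneg (Finset.prod_nonneg fun v _ => Finset.prod_nonneg fun k _ => hf _ _)
      (Finset.prod_nonneg fun v _ => Finset.prod_nonneg fun k _ => hg _ _)

theorem sum_kernel_le_sum_homWeight_pow {V₁ V₂ : Type*} {X Y : Type u} [Fintype V₁] [Fintype V₂]
    [DecidableEq V₁] [DecidableEq V₂] [Fintype X] [Fintype Y] (G : Bigraph V₁ V₂)
    {f : V₁ → X → ℝ} {g : V₂ → Y → ℝ} {W : X × Y → ℝ} (hf : ∀ v x, 0 ≤ f v x)
    (hg : ∀ w y, 0 ≤ g w y) (hW : ∀ p, 0 ≤ W p) {F : X → ℝ} {F' : Y → ℝ}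
    (hF : ∀ x, F x ^ G.E.card = ∏ v, f v x) (hF' : ∀ y, F' y ^ G.E.card = ∏ w, g w y)
    {n : ℕ} (z₀ : Fin n → X × Y) :
    (∏ k, F (z₀ k).1 * F' (z₀ k).2 * W (z₀ k)) ^ G.E.card *
      ∑ x : V₁ → WordOrbit (Prod.fst ∘ z₀), ∑ y : V₂ → WordOrbit (Prod.snd ∘ z₀),
        ∏ e ∈ G.E, WordOrbit.kernel z₀ (x e.1) (y e.2) ≤
      (∑ q, G.homWeight f g W q) ^ n := by
  classical
  let ι : (V₁ → WordOrbit (Prod.fst ∘ z₀)) × (V₂ → WordOrbit (Prod.snd ∘ z₀)) →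
      (Fin n → (V₁ → X) × (V₂ → Y)) := fun p k => (fun v => (p.1 v).1 k, fun w => (p.2 w).1 k)
  have hι : Function.Injective ι := fun p p' h => Prod.ext
    (funext fun v => Subtype.ext (funext fun k => congrFun (congrArg Prod.fst (congrFun h k)) v))
    (funext fun w => Subtype.ext (funext fun k => congrFun (congrArg Prod.snd (congrFun h k)) w))
  rw [← Fintype.sum_prod_type', Finset.mul_sum]
  exact sum_le_sum_pow_of_injective hι (G.homWeight_nonneg hf hg hW) fun p =>
    G.prod_kernel_le_prod_homWeight hf hg hW hF hF' z₀ p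

theorem LeftRegularSidorenko.pow_le {V₁ V₂ : Type*} {X Y : Type u} [Fintype V₁] [Fintype V₂]
    [DecidableEq V₁] [DecidableEq V₂] [Fintype X] [Fintype Y] [Nonempty X] [Nonempty Y]
    {G : Bigraph V₁ V₂} (hG : LeftRegularSidorenko.{u} G) (hiso : G.NoIsolated)
    {f : V₁ → X → ℝ} {g : V₂ → Y → ℝ} {W : X × Y → ℝ} (hf : ∀ v x, 0 ≤ f v x)
    (hg : ∀ w y, 0 ≤ g w y) (hW : ∀ p, 0 ≤ W p) {F : X → ℝ} {F' : Y → ℝ}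
    (hF0 : ∀ x, 0 ≤ F x) (hF'0 : ∀ y, 0 ≤ F' y)
    (hF : ∀ x, F x ^ G.E.card = ∏ v, f v x) (hF' : ∀ y, F' y ^ G.E.card = ∏ w, g w y) :
    (∑ p : X × Y, F p.1 * F' p.2 * W p) ^ G.E.card ≤
      (Fintype.card X : ℝ) ^ (G.E.card - Fintype.card V₁) *
        (Fintype.card Y : ℝ) ^ (G.E.card - Fintype.card V₂) * ∑ q, G.homWeight f g W q := by
  classical
  set e := G.E.card
  set R := ∑ q, G.homWeight f g W q with hR
  have hR0 : 0 ≤ R := Finset.sum_nonneg fun q _ => G.homWeight_nonneg hf hg hW q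
  refine le_of_pow_le_poly_mul_pow (by positivity) (Fintype.card (X × Y) * e) fun n => ?_
  obtain ⟨z₀, hz₀⟩ := exists_orbit_sum_le n
    (fun z : Fin n → X × Y => ∏ k, F (z k).1 * F' (z k).2 * W (z k))
    (fun z => Finset.prod_nonneg fun k _ => mul_nonneg (mul_nonneg (hF0 _) (hF'0 _)) (hW _))
    fun z π => Equiv.prod_comp π fun k => F (z k).1 * F' (z k).2 * W (z k)
  rw [← Fintype.sum_pow fun p : X × Y => F p.1 * F' p.2 * W p] at hz₀
  set S := ∑ p : X × Y, F p.1 * F' p.2 * W p with hS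
  have hS0 : 0 ≤ S :=
    Finset.sum_nonneg fun p _ => mul_nonneg (mul_nonneg (hF0 _) (hF'0 _)) (hW _)
  have hk := G.sum_kernel_le_sum_homWeight_pow hf hg hW hF hF' z₀
  set Φ := ∏ k, F (z₀ k).1 * F' (z₀ k).2 * W (z₀ k) with hΦ
  have hΦ0 : 0 ≤ Φ :=
    Finset.prod_nonneg fun k _ => mul_nonneg (mul_nonneg (hF0 _) (hF'0 _)) (hW _)
  have hs := WordOrbit.sum_kernel_pos z₀
  have hle := hG.le_sum (WordOrbit.kernel_nonneg z₀) hs (WordOrbit.sum_kernel_eq z₀)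
  have hcard := WordOrbit.card_prod_le z₀
  set s := ∑ b, WordOrbit.kernel z₀ ⟨Prod.fst ∘ z₀, 1, rfl⟩ b
  have hA := WordOrbit.card_le (x₀ := Prod.fst ∘ z₀)
  have hB := WordOrbit.card_le (x₀ := Prod.snd ∘ z₀)
  have hB0 : 0 < Fintype.card (WordOrbit (Prod.snd ∘ z₀)) := Fintype.card_pos
  set a := Fintype.card (WordOrbit (Prod.fst ∘ z₀))
  set b := Fintype.card (WordOrbit (Prod.snd ∘ z₀))
  have hA' : (a : ℝ) ≤ (Fintype.card X : ℝ) ^ n := by exact_mod_cast hA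
  have hB' : (b : ℝ) ≤ (Fintype.card Y : ℝ) ^ n := by exact_mod_cast hB
  have hb0 : (0 : ℝ) < b := by exact_mod_cast hB0
  have hm := hiso.card_left_le
  have hk' := hiso.card_right_le
  calc (S ^ e) ^ n = (S ^ n) ^ e := by rw [← pow_mul, ← pow_mul, mul_comm]
    _ ≤ (((n : ℝ) + 1) ^ Fintype.card (X × Y) * ((a * s) * Φ)) ^ e := by
      refine pow_le_pow_left₀ (pow_nonneg hS0 n) (hz₀.trans ?_) e
      gcongr
    _ = ((n : ℝ) + 1) ^ (Fintype.card (X × Y) * e) * ((a : ℝ) ^ (e - Fintype.card V₁) *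
          (b : ℝ) ^ (e - Fintype.card V₂) * (Φ ^ e * ((a : ℝ) ^ Fintype.card V₁ *
          (b : ℝ) ^ Fintype.card V₂ * (s / b) ^ e))) := by
      -- The powers are split so that `hle` applies; the leftover powers of `a` and `b` are bounded
      -- through `|X|^n` and `|Y|^n`. Absence of isolated vertices makes the natural-number
      -- subtractions exact.
      have h1 : (a : ℝ) ^ e = (a : ℝ) ^ (e - Fintype.card V₁) * (a : ℝ) ^ Fintype.card V₁ := by
        rw [← pow_add, Nat.sub_add_cancel hm]
      have h2 : s ^ e = (b : ℝ) ^ (e - Fintype.card V₂) * (b : ℝ) ^ Fintype.card V₂ *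
          (s / b) ^ e := by
        rw [← pow_add, Nat.sub_add_cancel hk', ← mul_pow, mul_div_cancel₀ _ hb0.ne']
      rw [mul_pow, mul_pow, mul_pow, ← pow_mul, h1, h2]
      ring
    _ ≤ ((n : ℝ) + 1) ^ (Fintype.card (X × Y) * e) *
        (((Fintype.card X : ℝ) ^ n) ^ (e - Fintype.card V₁) *
          ((Fintype.card Y : ℝ) ^ n) ^ (e - Fintype.card V₂) * R ^ n) := by
      have h3 := (mul_le_mul_of_nonneg_left hle (pow_nonneg hΦ0 e)).trans hk
      gcongr
    _ = _ := by
      rw [mul_pow, mul_pow, ← pow_mul, ← pow_mul, ← pow_mul, ← pow_mul, mul_comm n,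
        mul_comm n]

end Bigraph

/-! ### From finite sets to probability spaces by sampling. -/

theorem measurePreserving_comp_injective {ι κ X : Type*} [Fintype ι] [Fintype κ]
    [MeasurableSpace X] (μ : Measure X) [IsProbabilityMeasure μ] {φ : κ → ι}
    (hφ : Function.Injective φ) :
    MeasurePreserving (fun x : ι → X => x ∘ φ) (Measure.pi fun _ => μ) (Measure.pi fun _ => μ) := by
  have hm : Measurable fun x : ι → X => x ∘ φ :=
    measurable_pi_lambda _ fun k => measurable_pi_apply (φ k)
  refine ⟨hm, (Measure.pi_eq fun s hs => ?_).symm⟩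
  rw [Measure.map_apply hm (MeasurableSet.univ_pi hs)]
  have hpre : (fun x : ι → X => x ∘ φ) ⁻¹' Set.pi Set.univ s =
      Set.pi Set.univ (Function.extend φ s fun _ => Set.univ) := by
    ext x
    simp only [Set.mem_preimage, Set.mem_pi, Set.mem_univ, true_imp_iff, Function.comp_apply]
    refine ⟨fun h i => ?_, fun h k => by simpa [hφ.extend_apply] using h (φ k)⟩
    by_cases hi : ∃ k, φ k = i
    · obtain ⟨k, rfl⟩ := hi
      rw [hφ.extend_apply]
      exact h k
    · rw [Function.extend_apply' _ _ _ hi]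
      trivial
  rw [hpre, Measure.pi_pi]
  refine (Fintype.prod_of_injective φ hφ _ _ (fun i hi => ?_) fun k => ?_).symm
  · rw [Function.extend_apply' _ _ _ hi, measure_univ]
  · rw [hφ.extend_apply]

namespace IsBddMeasNonneg

variable {α β : Type*} [MeasurableSpace α] [MeasurableSpace β] {f g : α → ℝ}

theorem comp (hf : IsBddMeasNonneg f) {h : β → α} (hh : Measurable h) :
    IsBddMeasNonneg fun b => f (h b) :=
  ⟨hf.1.comp hh, fun _ => hf.2.1 _, hf.2.2.imp fun _ hM _ => hM _⟩

theorem mul (hf : IsBddMeasNonneg f) (hg : IsBddMeasNonneg g) :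
    IsBddMeasNonneg fun a => f a * g a := by
  obtain ⟨M, hM⟩ := hf.2.2
  obtain ⟨N, hN⟩ := hg.2.2
  exact ⟨hf.1.mul hg.1, fun a => mul_nonneg (hf.2.1 a) (hg.2.1 a), M * N, fun a =>
    mul_le_mul (hM a) (hN a) (hg.2.1 a) ((hf.2.1 a).trans (hM a))⟩

theorem prod {ι : Type*} (s : Finset ι) {F : ι → α → ℝ} (hF : ∀ i ∈ s, IsBddMeasNonneg (F i)) :
    IsBddMeasNonneg fun a => ∏ i ∈ s, F i a := by
  classical
  induction s using Finset.induction_on with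
  | empty => exact ⟨by simp, by simp, 1, by simp⟩
  | insert i s hi ih =>
    simp only [Finset.prod_insert hi]
    exact (hF i (Finset.mem_insert_self i s)).mul
      (ih fun j hj => hF j (Finset.mem_insert_of_mem hj))

theorem sum {ι : Type*} (s : Finset ι) {F : ι → α → ℝ} (hF : ∀ i ∈ s, IsBddMeasNonneg (F i)) :
    IsBddMeasNonneg fun a => ∑ i ∈ s, F i a := by
  refine ⟨Finset.measurable_sum s fun i hi => (hF i hi).1,
    fun a => Finset.sum_nonneg fun i hi => (hF i hi).2.1 a, ?_⟩
  choose! M hM using fun i hi => (hF i hi).2.2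
  exact ⟨∑ i ∈ s, M i, fun a => Finset.sum_le_sum fun i hi => hM i hi a⟩

theorem pow (hf : IsBddMeasNonneg f) (n : ℕ) : IsBddMeasNonneg fun a => f a ^ n := by
  simpa using prod (Finset.range n) (F := fun _ => f) fun _ _ => hf

theorem rpow (hf : IsBddMeasNonneg f) {c : ℝ} (hc : 0 ≤ c) : IsBddMeasNonneg fun a => f a ^ c := by
  obtain ⟨M, hM⟩ := hf.2.2
  exact ⟨hf.1.pow_const c, fun a => Real.rpow_nonneg (hf.2.1 a) c, M ^ c, fun a =>
    Real.rpow_le_rpow (hf.2.1 a) (hM a) hc⟩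

theorem integrable (hf : IsBddMeasNonneg f) (μ : Measure α) [IsFiniteMeasure μ] :
    Integrable f μ := by
  obtain ⟨M, hM⟩ := hf.2.2
  exact Integrable.of_bound hf.1.aestronglyMeasurable M
    (.of_forall fun a => by rw [Real.norm_of_nonneg (hf.2.1 a)]; exact hM a)

theorem pow_integral_le (hf : IsBddMeasNonneg f) (μ : Measure α) [IsProbabilityMeasure μ] (n : ℕ) :
    (∫ a, f a ∂μ) ^ n ≤ ∫ a, f a ^ n ∂μ :=
  (convexOn_pow n).map_integral_le (continuous_pow n).continuousOn isClosed_Ici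
    (.of_forall hf.2.1) (hf.integrable μ) ((hf.pow n).integrable μ)

end IsBddMeasNonneg

/-- The proportion of injective maps among all maps from a fixed set to a large set tends to one. -/
theorem tendsto_descFactorial_div_pow (k : ℕ) :
    Filter.Tendsto (fun N : ℕ => (N.descFactorial k : ℝ) / (N : ℝ) ^ k) Filter.atTop (nhds 1) := by
  refine (Asymptotics.isEquivalent_iff_tendsto_one ?_).1 (isEquivalent_descFactorial k)
  filter_upwards [Filter.eventually_gt_atTop 0] with N hN
  positivity

theorem card_filter_injective_prod (V₁ V₂ : Type*) [Fintype V₁] [Fintype V₂] [DecidableEq V₁]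
    [DecidableEq V₂] {I : Type*} [Fintype I] [DecidablePred fun q : (V₁ → I) × (V₂ → I) =>
      Function.Injective q.1 ∧ Function.Injective q.2] :
    ((Finset.univ : Finset ((V₁ → I) × (V₂ → I))).filter fun q =>
      Function.Injective q.1 ∧ Function.Injective q.2).card =
      (Fintype.card I).descFactorial (Fintype.card V₁) *
        (Fintype.card I).descFactorial (Fintype.card V₂) := by
  classical
  rw [← Fintype.card_embedding_eq, ← Fintype.card_embedding_eq, ← Fintype.card_prod,
    ← Fintype.card_subtype]
  refine Fintype.card_congr
    { toFun := fun q => (⟨q.1.1, q.2.1⟩, ⟨q.1.2, q.2.2⟩)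
      invFun := fun p => ⟨(p.1, p.2), p.1.injective, p.2.injective⟩
      left_inv := fun q => rfl
      right_inv := fun p => rfl }

namespace Bigraph

variable {V₁ V₂ : Type*} [Fintype V₁] [Fintype V₂]

theorem homWeight_isBddMeasNonneg (G : Bigraph V₁ V₂) {X Y : Type*} [MeasurableSpace X]
    [MeasurableSpace Y] {f : V₁ → X → ℝ} {g : V₂ → Y → ℝ} {W : X × Y → ℝ}
    (hf : ∀ v, IsBddMeasNonneg (f v)) (hg : ∀ w, IsBddMeasNonneg (g w)) (hW : IsBddMeasNonneg W) :
    IsBddMeasNonneg (G.homWeight f g W) := by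
  refine ((IsBddMeasNonneg.prod Finset.univ fun v _ => ?_).mul
    (IsBddMeasNonneg.prod Finset.univ fun w _ => ?_)).mul
    (IsBddMeasNonneg.prod G.E fun e _ => ?_)
  · exact (hf v).comp ((measurable_pi_apply v).comp measurable_fst)
  · exact (hg w).comp ((measurable_pi_apply w).comp measurable_snd)
  · exact hW.comp (((measurable_pi_apply e.1).comp measurable_fst).prodMk
      ((measurable_pi_apply e.2).comp measurable_snd))

theorem measurable_sample {X Y I : Type*} [MeasurableSpace X] [MeasurableSpace Y] (p : I × I) :
    Measurable fun z : (I → X) × (I → Y) => (z.1 p.1, z.2 p.2) :=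
  ((measurable_pi_apply p.1).comp measurable_fst).prodMk
    ((measurable_pi_apply p.2).comp measurable_snd)

theorem measurable_sample_comp {V₁ V₂ X Y I : Type*} [MeasurableSpace X] [MeasurableSpace Y]
    (q : (V₁ → I) × (V₂ → I)) :
    Measurable fun z : (I → X) × (I → Y) => (z.1 ∘ q.1, z.2 ∘ q.2) :=
  Measurable.prodMk
    (measurable_pi_lambda _ fun v => (measurable_pi_apply (q.1 v)).comp measurable_fst)
    (measurable_pi_lambda _ fun w => (measurable_pi_apply (q.2 w)).comp measurable_snd)

/-- Averaging the homomorphism sum over random samples recovers the density, up to the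
contribution of the non-injective maps. -/
theorem integral_sum_homWeight_le (G : Bigraph V₁ V₂) {X Y I : Type*} [MeasurableSpace X]
    [MeasurableSpace Y] [Fintype I] [DecidableEq V₁] [DecidableEq V₂]
    (μ : Measure X) (ν : Measure Y) [IsProbabilityMeasure μ] [IsProbabilityMeasure ν]
    {f : V₁ → X → ℝ} {g : V₂ → Y → ℝ} {W : X × Y → ℝ}
    (hf : ∀ v, IsBddMeasNonneg (f v)) (hg : ∀ w, IsBddMeasNonneg (g w)) (hW : IsBddMeasNonneg W)
    {L : ℝ} (hL : ∀ q, G.homWeight f g W q ≤ L) :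
    ∫ z : (I → X) × (I → Y), ∑ q : (V₁ → I) × (V₂ → I), G.homWeight f g W (z.1 ∘ q.1, z.2 ∘ q.2)
        ∂((Measure.pi fun _ => μ).prod (Measure.pi fun _ => ν)) ≤
      (Fintype.card I : ℝ) ^ Fintype.card V₁ * (Fintype.card I : ℝ) ^ Fintype.card V₂ *
        (G.weightedDensity μ ν f g W + L) -
      ((Fintype.card I).descFactorial (Fintype.card V₁) : ℝ) *
        ((Fintype.card I).descFactorial (Fintype.card V₂) : ℝ) * L := by
  classical
  have hh := G.homWeight_isBddMeasNonneg hf hg hW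
  have ht : 0 ≤ G.weightedDensity μ ν f g W := integral_nonneg hh.2.1
  -- An injective pair of maps reads off independent sample points and gives exactly the density;
  -- any other pair contributes at most `L`.
  have hbound (q : (V₁ → I) × (V₂ → I)) :
      ∫ z : (I → X) × (I → Y), G.homWeight f g W (z.1 ∘ q.1, z.2 ∘ q.2)
        ∂((Measure.pi fun _ => μ).prod (Measure.pi fun _ => ν)) ≤
      G.weightedDensity μ ν f g W + L -
        if Function.Injective q.1 ∧ Function.Injective q.2 then L else 0 := by
    split_ifs with hq
    · have hmp := (measurePreserving_comp_injective μ hq.1).prod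
        (measurePreserving_comp_injective ν hq.2)
      rw [add_sub_cancel_right, weightedDensity, ← hmp.map_eq,
        integral_map hmp.measurable.aemeasurable]
      · exact le_rfl
      · exact hh.1.aestronglyMeasurable
    · rw [sub_zero]
      refine le_add_of_nonneg_of_le ht ?_
      refine (integral_mono ((hh.comp (measurable_sample_comp q)).integrable _) (integrable_const L)
        fun z => hL _).trans ?_
      simp
  rw [integral_finsetSum _ fun q _ => (hh.comp (measurable_sample_comp q)).integrable _]
  refine (Finset.sum_le_sum fun q _ => hbound q).trans_eq ?_
  rw [Finset.sum_sub_distrib, Finset.sum_const, ← Finset.sum_filter, Finset.sum_const,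
    card_filter_injective_prod]
  simp [mul_assoc, mul_add]

theorem integral_sum_pairs {X Y I : Type*} [MeasurableSpace X]
    [MeasurableSpace Y] [Fintype I] (μ : Measure X) (ν : Measure Y)
    [IsProbabilityMeasure μ] [IsProbabilityMeasure ν] {T : X × Y → ℝ} (hT : IsBddMeasNonneg T) :
    ∫ z : (I → X) × (I → Y), ∑ p : I × I, T (z.1 p.1, z.2 p.2)
        ∂((Measure.pi fun _ => μ).prod (Measure.pi fun _ => ν)) =
      (Fintype.card I : ℝ) ^ 2 * ∫ z, T z ∂(μ.prod ν) := by
  have hmp (p : I × I) := (measurePreserving_eval (fun _ : I => μ) p.1).prod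
        (measurePreserving_eval (fun _ : I => ν) p.2)
  have hint (p : I × I) : ∫ z : (I → X) × (I → Y), T (z.1 p.1, z.2 p.2)
        ∂((Measure.pi fun _ => μ).prod (Measure.pi fun _ => ν)) = ∫ z, T z ∂(μ.prod ν) := by
    rw [← (hmp p).map_eq, integral_map (hmp p).measurable.aemeasurable
      hT.1.aestronglyMeasurable]
    rfl
  rw [integral_finsetSum _ fun p _ => (hT.comp (measurable_sample p)).integrable _,
    Finset.sum_congr rfl fun p _ => hint p]
  simp [sq]

/-- The finite inequality holds for every sample; integrating it and applying Jensen to the power on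
the left compares the two densities. -/
theorem LeftRegularSidorenko.pow_integral_le [DecidableEq V₁] [DecidableEq V₂]
    {G : Bigraph V₁ V₂} (hG : LeftRegularSidorenko.{u} G) (hiso : G.NoIsolated) {X Y : Type u}
    [MeasurableSpace X] [MeasurableSpace Y] (μ : Measure X) (ν : Measure Y)
    [IsProbabilityMeasure μ] [IsProbabilityMeasure ν]
    {f : V₁ → X → ℝ} {g : V₂ → Y → ℝ} {W : X × Y → ℝ}
    (hf : ∀ v, IsBddMeasNonneg (f v)) (hg : ∀ w, IsBddMeasNonneg (g w)) (hW : IsBddMeasNonneg W)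
    {F : X → ℝ} {F' : Y → ℝ} (hFb : IsBddMeasNonneg F) (hFb' : IsBddMeasNonneg F')
    (hF : ∀ x, F x ^ G.E.card = ∏ v, f v x) (hF' : ∀ y, F' y ^ G.E.card = ∏ w, g w y)
    {L : ℝ} (hL : ∀ q, G.homWeight f g W q ≤ L) {I : Type u} [Fintype I] [Nonempty I] :
    ((Fintype.card I : ℝ) ^ 2 * ∫ z, F z.1 * F' z.2 * W z ∂(μ.prod ν)) ^ G.E.card ≤
      ((Fintype.card I : ℝ) ^ (G.E.card - Fintype.card V₁) *
        (Fintype.card I : ℝ) ^ (G.E.card - Fintype.card V₂)) *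
      ((Fintype.card I : ℝ) ^ Fintype.card V₁ * (Fintype.card I : ℝ) ^ Fintype.card V₂ *
        (G.weightedDensity μ ν f g W + L) -
      ((Fintype.card I).descFactorial (Fintype.card V₁) : ℝ) *
        ((Fintype.card I).descFactorial (Fintype.card V₂) : ℝ) * L) := by
  have hT : IsBddMeasNonneg fun z : X × Y => F z.1 * F' z.2 * W z :=
    ((hFb.comp measurable_fst).mul (hFb'.comp measurable_snd)).mul hW
  have hTp : IsBddMeasNonneg fun z : (I → X) × (I → Y) =>
      ∑ p : I × I, F (z.1 p.1) * F' (z.2 p.2) * W (z.1 p.1, z.2 p.2) :=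
    IsBddMeasNonneg.sum Finset.univ
      (F := fun (p : I × I) (z : (I → X) × (I → Y)) =>
        F (z.1 p.1) * F' (z.2 p.2) * W (z.1 p.1, z.2 p.2))
      fun p _ => hT.comp (measurable_sample p)
  have hhom : IsBddMeasNonneg fun z : (I → X) × (I → Y) => ∑ q : (V₁ → I) × (V₂ → I),
      G.homWeight f g W (z.1 ∘ q.1, z.2 ∘ q.2) :=
    IsBddMeasNonneg.sum Finset.univ
      (F := fun (q : (V₁ → I) × (V₂ → I)) (z : (I → X) × (I → Y)) =>
        G.homWeight f g W (z.1 ∘ q.1, z.2 ∘ q.2))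
      fun q _ => (G.homWeight_isBddMeasNonneg hf hg hW).comp (measurable_sample_comp q)
  have h1 := hTp.pow_integral_le ((Measure.pi fun _ => μ).prod (Measure.pi fun _ => ν)) G.E.card
  rw [integral_sum_pairs μ ν hT] at h1
  have hpt (z : (I → X) × (I → Y)) :
      (∑ p : I × I, F (z.1 p.1) * F' (z.2 p.2) * W (z.1 p.1, z.2 p.2)) ^ G.E.card ≤
      ((Fintype.card I : ℝ) ^ (G.E.card - Fintype.card V₁) *
        (Fintype.card I : ℝ) ^ (G.E.card - Fintype.card V₂)) *
        ∑ q : (V₁ → I) × (V₂ → I), G.homWeight f g W (z.1 ∘ q.1, z.2 ∘ q.2) :=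
    hG.pow_le hiso (X := I) (Y := I) (f := fun v i => f v (z.1 i))
      (g := fun w i => g w (z.2 i)) (W := fun p => W (z.1 p.1, z.2 p.2))
      (F := fun i => F (z.1 i)) (F' := fun i => F' (z.2 i)) (fun v i => (hf v).2.1 _)
      (fun w i => (hg w).2.1 _) (fun p => hW.2.1 _) (fun i => hFb.2.1 _) (fun i => hFb'.2.1 _)
      (fun i => hF _) (fun i => hF' _)
  have h2 := integral_mono ((hTp.pow G.E.card).integrable _) ((hhom.integrable
    ((Measure.pi fun _ => μ).prod (Measure.pi fun _ => ν))).const_mul _) hpt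
  rw [integral_const_mul] at h2
  exact (h1.trans h2).trans (mul_le_mul_of_nonneg_left
    (G.integral_sum_homWeight_le (I := I) μ ν hf hg hW hL) (by positivity))

theorem LeftRegularSidorenko.strongSidorenko [DecidableEq V₁] {G : Bigraph V₁ V₂}
    (hG : LeftRegularSidorenko.{u} G) (hiso : G.NoIsolated) (he : G.Nontrivial) :
    StrongSidorenko.{u} G := by
  classical
  intro X Y _ _ μ ν _ _ W f g hW hf hg
  have he0 : G.E.card ≠ 0 := he.card_ne_zero
  have hc : 0 ≤ 1 / (G.E.card : ℝ) := by positivity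
  have hFb : IsBddMeasNonneg fun x => ∏ v, f v x ^ (1 / (G.E.card : ℝ)) :=
    IsBddMeasNonneg.prod _ fun v _ => (hf v).rpow hc
  have hFb' : IsBddMeasNonneg fun y => ∏ w, g w y ^ (1 / (G.E.card : ℝ)) :=
    IsBddMeasNonneg.prod _ fun w _ => (hg w).rpow hc
  have hF : ∀ x, (∏ v, f v x ^ (1 / (G.E.card : ℝ))) ^ G.E.card = ∏ v, f v x := fun x => by
    simp only [← Finset.prod_pow, one_div]
    exact Finset.prod_congr rfl fun v _ => Real.rpow_inv_natCast_pow ((hf v).2.1 x) he0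
  have hF' : ∀ y, (∏ w, g w y ^ (1 / (G.E.card : ℝ))) ^ G.E.card = ∏ w, g w y := fun y => by
    simp only [← Finset.prod_pow, one_div]
    exact Finset.prod_congr rfl fun w _ => Real.rpow_inv_natCast_pow ((hg w).2.1 y) he0
  obtain ⟨L, hL⟩ := (G.homWeight_isBddMeasNonneg hf hg hW).2.2
  have hm := hiso.card_left_le
  have hk := hiso.card_right_le
  -- The index set is lifted because left-regularity is available for finite sets in the universe
  -- `u`.
  have hsample : ∀ N : ℕ, 0 < N → _ := fun N hN =>
    haveI : Nonempty (ULift.{u} (Fin N)) := ⟨⟨⟨0, hN⟩⟩⟩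
    hG.pow_integral_le hiso μ ν hf hg hW hFb hFb' hF hF' hL (I := ULift.{u} (Fin N))
  simp only [Fintype.card_ulift, Fintype.card_fin] at hsample
  change G.weightedEdgeDensity μ ν f g W ^ G.E.card ≤ G.weightedDensity μ ν f g W
  change ∀ N : ℕ, 0 < N → ((N : ℝ) ^ 2 * G.weightedEdgeDensity μ ν f g W) ^ G.E.card ≤ _ at hsample
  generalize G.weightedEdgeDensity μ ν f g W = Z at hsample ⊢
  generalize G.weightedDensity μ ν f g W = t at hsample ⊢
  generalize Fintype.card V₁ = m at hm hsample
  generalize Fintype.card V₂ = k at hk hsample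
  generalize G.E.card = e at hm hk hsample ⊢
  -- Dividing by `N^(2e)` leaves the density plus `L` times the proportion of non-injective pairs,
  -- which tends to 0.
  have key : ∀ N : ℕ, 0 < N → Z ^ e ≤
      t + L - (N.descFactorial m : ℝ) / (N : ℝ) ^ m *
        ((N.descFactorial k : ℝ) / (N : ℝ) ^ k) * L := by
    intro N hN
    have h4 := hsample N hN
    have hN0 : (0 : ℝ) < N := by exact_mod_cast hN
    have e1 : (N : ℝ) ^ e = (N : ℝ) ^ (e - m) * (N : ℝ) ^ m := by
      rw [← pow_add, Nat.sub_add_cancel hm]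
    have e2 : (N : ℝ) ^ e = (N : ℝ) ^ (e - k) * (N : ℝ) ^ k := by
      rw [← pow_add, Nat.sub_add_cancel hk]
    have e3 : ((N : ℝ) ^ 2 * Z) ^ e = (N : ℝ) ^ (e - m) * (N : ℝ) ^ m *
        ((N : ℝ) ^ (e - k) * (N : ℝ) ^ k) * Z ^ e := by
      rw [← e1, ← e2, mul_pow, sq, mul_pow]
    have h5 : (N : ℝ) ^ (e - m) * (N : ℝ) ^ m * ((N : ℝ) ^ (e - k) * (N : ℝ) ^ k) * Z ^ e ≤
        (N : ℝ) ^ (e - m) * (N : ℝ) ^ m * ((N : ℝ) ^ (e - k) * (N : ℝ) ^ k) *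
        (t + L - (N.descFactorial m : ℝ) / (N : ℝ) ^ m *
          ((N.descFactorial k : ℝ) / (N : ℝ) ^ k) * L) := by
      rw [← e3]
      refine h4.trans_eq ?_
      field_simp
    exact le_of_mul_le_mul_left h5 (by positivity)
  have hlim : Filter.Tendsto (fun N : ℕ => t + L - (N.descFactorial m : ℝ) / (N : ℝ) ^ m *
      ((N.descFactorial k : ℝ) / (N : ℝ) ^ k) * L) Filter.atTop (nhds (t + L - 1 * 1 * L)) :=
    tendsto_const_nhds.sub (((tendsto_descFactorial_div_pow m).mul
      (tendsto_descFactorial_div_pow k)).mul_const L)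
  have := ge_of_tendsto hlim ((Filter.eventually_gt_atTop 0).mono key)
  simpa using this

end Bigraph

theorem mainTheorem4 {V₁ V₂ C : Type*} [Fintype V₁] [Fintype V₂]
    (H : ColoredBigraph V₁ V₂ C)
    (hnontrivial : H.graph.Nontrivial)
    (hisolated : H.graph.NoIsolated)
    (huniform : H.RightUniform)
    (htransitive : H.ColorEdgeTransitive)
    (hholder : ColoredBigraph.LeftWeaklyHolder.{u} H) :
    (∀ (V₂' : Type*) [Fintype V₂'] (G : Bigraph V₁ V₂'),
      G.NoIsolated →
      (∀ U : Finset V₁, 2 ≤ U.card → (H.orbitSum G U = 0 ↔ H.orbitSum H.graph U = 0)) →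
      (∀ U : Finset V₁, 2 ≤ U.card → H.orbitSum H.graph U ≤ H.orbitSum G U) →
      Bigraph.StrongSidorenko.{u} G) ∧
    Bigraph.StrongSidorenko.{u} H.graph := by
  classical
  obtain ⟨⟨v₀, w₀⟩, -⟩ := id hnontrivial
  have : Nonempty V₁ := ⟨v₀⟩
  refine ⟨fun V₂' _ G hG h0 hle => ?_, ?_⟩
  · obtain ⟨w, hw⟩ := hG.1 v₀
    exact (Bigraph.leftRegularSidorenko_of_orbitSum hisolated huniform htransitive hholder G
      h0 hle).strongSidorenko hG ⟨_, hw⟩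
  · exact (Bigraph.leftRegularSidorenko_of_orbitSum hisolated huniform htransitive hholder H.graph
      (fun _ _ => Iff.rfl) fun _ _ => le_rfl).strongSidorenko hisolated hnontrivial
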